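/- **Setting.** Let $X$ be a locally compact, second countable Hausdorff space with a Borel measure $dx$ that is finite on compact sets and positive on non-empty open sets (for instance $\mathbb R^d$ with Lebesgue measure). Let $A$ be a (closed, densely defined) self-adjoint operator on the real space $L^2(X)$ that is positive definite, $\langle f,Af\rangle>0$ for $0\neq f\in\mathrm{Dom}(A)$; $A^{-1}$ may be unbounded and is understood in the sense of quadratic forms. Let $U\subset X\times X$ be an open set of pairs of points on which the integral kernels $(e^{-uA})_{xy}$ ($u>0$), $C_{xy}=(A^{-1})_{xy}$ and $(e^{-uA}/A)_{xy}$ ($u\ge 0$) exist and are continuous in $(x,y)$, the first one jointly in $(u,x,y)$ (for instance $U=X\times X$, or the complement of the diagonal). Assume that the integral $\int_0^\infty (e^{-uA})_{xy}\,du$ converges absolutely for $(x,y)\in U$ and that $|C|_{xy}:=\int_0^\infty |(e^{-uA})_{xy}|\,du$ is continuous on $U$. For every $d$ let the vertex kernel $V(x^1,\dots,x^d)\,dx^1\cdots dx^d$ be a cyclically symmetric signed measure on $X^d$, given by a real measurable density with respect to a positive $\sigma$-finite measure, both cyclically symmetric (so that integrable or merely measurable functions as well as local kernels $g\prod_{i\ge2}\delta(x^1-x^i)$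 are allowed). **Maps and forests.** Let $\mathcal G$ be a possibly disconnected rooted combinatorial map: a finite set of half-edges with a permutation $\sigma$, whose cycles are the vertices, and a fixed-point-free involution $\alpha$, whose cycles are the edges. The fixed points of $\sigma$ are the external vertices $r^1,\dots,r^n$, all other vertices are internal; every connected component contains an external vertex, one of which is designated as its root. The half-edges of an internal vertex $v$ of degree $d(v)$ are numbered $v^1,\dots,v^{d(v)}$ in the cyclic order given by $\sigma$, starting anywhere; the half-edge $v^h$ has a position $x_v^h\in X$, which is integrated over, and the external vertex $r^\nu$ has a fixed position $x^\nu$. A spanning forest $\mathcal F\prec\mathcal G$ is a set of edges which is a spanning forest of $\mathcal G$, each of whose trees contains exactly one external vertex, its root (a tree may consist of its root alone); its edges are written $(v^h,w^1)$, where $v$ is the parent of $w$ and the half-edges of $w$ are numbered starting with the one that points towards the root. Assume that for every edge $\{h,h'\}$ of $\mathcal G$ the pairs of positions $(x_h,x_{h'})$ and $(x_{h'},x_h)$ belong to $U$ for almost all values of the integrated positions with respect to the product of the measures underlying the vertex kernels. **Amplitudes.** The Feynman amplitude is $$\mathcal A(\mathcal G)=\int\Big(\prod_{v\ \mathrm{int.}}\prod_{h=1}^{d(v)}dx_v^h\Big)\prod_{\{v^h,w^{h'}\}\in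 E(\mathcal G)}C_{x_v^h x_w^{h'}}\prod_{v\ \mathrm{int.}}\big(-V(x_v^1,\dots,x_v^{d(v)})\big).$$ Give all the external vertices the same fictitious time $t\in\mathbb R$ and every internal vertex $v$ a time $t_v\in\mathbb R$. The stochastic amplitude of $\mathcal F\prec\mathcal G$ is $$A(\mathcal G,\mathcal F)=\int\prod_{v\ \mathrm{int.}}dt_v\int\Big(\prod_{v\ \mathrm{int.}}\prod_{h=1}^{d(v)}dx_v^h\Big)\prod_{(v^h,w^1)\in E(\mathcal F)}\theta(t_v-t_w)\big(e^{-(t_v-t_w)A}\big)_{x_v^hx_w^1}\prod_{\{v^h,w^{h'}\}\in E(\mathcal G)\setminus E(\mathcal F)}\Big(\frac{e^{-|t_v-t_w|A}}{A}\Big)_{x_v^hx_w^{h'}}\prod_{v\ \mathrm{int.}}\big(-V(x_v^1,\dots,x_v^{d(v)})\big).$$ **Theorem 2.** 1. If the Feynman amplitude converges absolutely after $C$ has been replaced by $|C|$ (when the heat kernel is nonnegative on $U$ this is the absolute convergence of $\mathcal A(\mathcal G)$ itself), then $A(\mathcal G,\mathcal F)$ converges absolutely, as an integral over all times and positions, for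 every $\mathcal F\prec\mathcal G$. 2. Whenever $A(\mathcal G,\mathcal F)$ converges absolutely for every $\mathcal F\prec\mathcal G$, the Feynman amplitude $\mathcal A(\mathcal G)$ converges absolutely as well, and $$\mathcal A(\mathcal G)=\sum_{\mathcal F\prec\mathcal G}A(\mathcal G,\mathcal F).$$ -/

import Mathlib

open MeasureTheory Set Filter Topology
open scoped RealInnerProductSpace CompactlySupported

/-! ### Rooted combinatorial maps -/

/-- A possibly disconnected rooted combinatorial map with finite set of half-edges `D` and `n`
labelled external vertices. The cycles of `σ` are the vertices (cyclically ordered half-edges),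
the cycles `{h, α h}` of the fixed-point-free involution `α` are the edges. The external vertices
are the fixed points of `σ`, enumerated by `ext`. Every connected component (orbit of the group
generated by `σ` and `α`) contains exactly one external vertex designated as its root. -/
structure CombMap (n : ℕ) (D : Type*) where
  σ : Equiv.Perm D
  α : Equiv.Perm D
  α_invol : ∀ h, α (α h) = h
  α_ne : ∀ h, α h ≠ h
  ext : Fin n ↪ D
  σ_fixed : ∀ h, σ h = h ↔ ∃ ν, ext ν = h
  IsRoot : Fin n → Prop
  exists_unique_root : ∀ h, ∃! ν, IsRoot ν ∧ ∃ η ∈ Subgroup.closure {σ, α}, η h = ext ν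

namespace CombMap

variable {n : ℕ} {D : Type*} (G : CombMap n D)

/-- Vertices: the cycles of `σ`. -/
abbrev Vertex : Type _ := Quotient (Equiv.Perm.SameCycle.setoid G.σ)

/-- The vertex to which a half-edge belongs. -/
def vertex (h : D) : G.Vertex := Quotient.mk (Equiv.Perm.SameCycle.setoid G.σ) h

/-- A vertex is external if it is one of the given univalent vertices. -/
def IsExt (v : G.Vertex) : Prop := ∃ ν, G.vertex (G.ext ν) = v

/-- Internal vertices. -/
abbrev Internal : Type _ := {v : G.Vertex // ¬ G.IsExt v}

noncomputable instance [Fintype D] : Fintype G.Internal := Fintype.ofFinite _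

/-- The degree of a vertex: the number of its half-edges. -/
noncomputable def deg (v : G.Vertex) : ℕ := Nat.card {h : D // G.vertex h = v}

/-- The edges: the unordered pairs `{h, α h}`. -/
noncomputable def edges [Fintype D] : Finset (Sym2 D) :=
  open Classical in Finset.univ.image fun h => s(h, G.α h)

/-- A choice of a first half-edge `v¹` on every internal vertex `v`; the half-edges of `v` are then
`v¹, v² = σ v¹, v³ = σ² v¹, …`. -/
abbrev Labelling : Type _ := {ℓ : G.Internal → D // ∀ v, G.vertex (ℓ v) = v.1}

/-- Every half-edge `h` of an internal vertex `v` is one of `v¹, …, v^d`, with `d` the degree. -/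
theorem exists_index [Fintype D] (ℓ : G.Labelling) (h : D) (hv : ¬ G.IsExt (G.vertex h)) :
    ∃ i : Fin (G.deg (G.vertex h)), (G.σ ^ (i : ℕ)) (ℓ.1 ⟨G.vertex h, hv⟩) = h := by
  classical
  set a := ℓ.1 ⟨G.vertex h, hv⟩ with ha
  have hsc : G.σ.SameCycle a h := Quotient.exact (ℓ.2 ⟨G.vertex h, hv⟩)
  have hmv : G.σ h ≠ h := fun hfix => by
    obtain ⟨ν, hν⟩ := (G.σ_fixed h).1 hfix
    exact hv ⟨ν, by rw [hν]⟩
  have hma : G.σ a ≠ a := fun hfix => by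
    have := hsc.apply_eq_self_iff.1 hfix
    exact hmv this
  obtain ⟨i, hi, hi'⟩ := hsc.exists_pow_eq_of_mem_support (Equiv.Perm.mem_support.2 hma)
  refine ⟨⟨i, lt_of_lt_of_le hi ?_⟩, hi'⟩
  rw [deg, Nat.card_eq_fintype_card, Fintype.card_subtype]
  refine Finset.card_le_card fun b hb => ?_
  rw [Equiv.Perm.mem_support_cycleOf_iff] at hb
  simp only [Finset.mem_filter, Finset.mem_univ, true_and]
  exact Quotient.sound (hb.1.symm.trans hsc)

/-- The (zero-based) label of a half-edge of an internal vertex. -/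
noncomputable def index [Fintype D] (ℓ : G.Labelling) (h : D) (hv : ¬ G.IsExt (G.vertex h)) :
    Fin (G.deg (G.vertex h)) := (G.exists_index ℓ h hv).choose

/-- The integration variables `x_v^i`: one point for every half-edge of every internal vertex. -/
abbrev Config (X : Type*) : Type _ := ∀ v : G.Internal, Fin (G.deg v.1) → X

/-- The position of a half-edge: a half-edge of an internal vertex has its own integration
variable, an external half-edge has the corresponding external position. -/
noncomputable def pos [Fintype D] {X : Type*} (ℓ : G.Labelling) (x : Fin n → X)
    (y : G.Config X) (h : D) : X :=
  open Classical in
  if hv : G.IsExt (G.vertex h) then x hv.choose else y ⟨G.vertex h, hv⟩ (G.index ℓ h hv)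

/-- The fictitious time of a vertex: `t` at the external vertices, `s v` at the internal ones. -/
noncomputable def time (t : ℝ) (s : G.Internal → ℝ) (v : G.Vertex) : ℝ :=
  open Classical in if hv : G.IsExt v then t else s ⟨v, hv⟩

/-- If the half-edge `w¹` of each internal vertex `w` belongs to the edge that joins `w` to its
parent, this is the map sending a vertex to its parent (external vertices are sent to
themselves). -/
noncomputable def parent (ℓ : G.Labelling) (v : G.Vertex) : G.Vertex :=
  open Classical in if hv : G.IsExt v then v else G.vertex (G.α (ℓ.1 ⟨v, hv⟩))

/-- Spanning forests of `G` consisting of one tree rooted at each external vertex. Such a forest is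
given by the half-edge `w¹` on each internal vertex `w` through which `w` is joined to its parent;
the requirement is that going from parent to parent one arrives at an external vertex. (The edges
`{w¹, α w¹}` then form a forest in which every component contains exactly one external vertex, and
`w¹` is the half-edge of `w` that points towards it; so the data are determined by the edges.) -/
def SpanningForest : Type _ :=
  {ℓ : G.Labelling // ∀ v, ∃ k : ℕ, G.IsExt ((G.parent ℓ)^[k] v)}

noncomputable instance [Fintype D] : Fintype G.SpanningForest :=
  have : Finite G.SpanningForest := by unfold SpanningForest; infer_instance
  Fintype.ofFinite _

/-- The edges `{v^h, w¹}` of a spanning forest, `w` running over the internal vertices and `v`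
being the parent of `w`. -/
noncomputable def SpanningForest.edges {G : CombMap n D} [Fintype D] (F : G.SpanningForest) :
    Finset (Sym2 D) :=
  open Classical in Finset.univ.image fun w : G.Internal => s(G.α (F.1.1 w), F.1.1 w)

end CombMap

/-! ### Vertex kernels -/

/-- Vertex kernels of all degrees. The kernel of degree `d` is the cyclically symmetric, possibly
singular, signed measure `V(x¹, …, x^d) dx¹ ⋯ dx^d := dens d x * d(ref d)(x)` on `X^d`. For a
kernel that is a function take for `ref d` the product measure `dx¹ ⋯ dx^d`; for a local
interaction take the image of `dx` under the diagonal embedding and a constant density. -/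
structure VertexKernels (X : Type*) [MeasurableSpace X] where
  ref : ∀ d : ℕ, Measure (Fin d → X)
  sigmaFinite : ∀ d, 0 < d → SigmaFinite (ref d)
  dens : ∀ d : ℕ, (Fin d → X) → ℝ
  measurable_dens : ∀ d, Measurable (dens d)
  ref_cyclic : ∀ d, MeasurePreserving (fun y : Fin d → X => y ∘ finRotate d) (ref d) (ref d)
  dens_cyclic : ∀ d (y : Fin d → X), dens d (y ∘ finRotate d) = dens d y

/-! ### Operators and their kernels -/

section Operators

variable {H : Type*} [NormedAddCommGroup H] [InnerProductSpace ℝ H]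

/-- `A` is positive definite. -/
def IsPosDefOp (A : H →ₗ.[ℝ] H) : Prop :=
  ∀ f : A.domain, f ≠ 0 → 0 < ⟪(f : H), A f⟫

/-- `T t = e^{-tA}` for `t ≥ 0`: the strongly continuous one-parameter semigroup whose
infinitesimal generator is `-A`. -/
structure IsHeatSemigroup (A : H →ₗ.[ℝ] H) (T : ℝ → H →L[ℝ] H) : Prop where
  zero : T 0 = 1
  add : ∀ s t, 0 ≤ s → 0 ≤ t → T (s + t) = (T s).comp (T t)
  continuousOn : ∀ f, ContinuousOn (fun t => T t f) (Ici 0)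
  generator : ∀ f g : H, (f, g) ∈ A.graph ↔ HasDerivWithinAt (fun t => T t f) (-g) (Ici 0) 0

/-- `q` is the value at `g` of the quadratic form of `A⁻¹` (that is `q = ‖A^{-1/2} g‖²`; it equals
`⟪g, A⁻¹ g⟫` if `g` is in the range of `A`), given by the Legendre transform of the form of `A`. -/
def IsInvForm (A : H →ₗ.[ℝ] H) (g : H) (q : ℝ) : Prop :=
  IsLUB (Set.range fun h : A.domain => 2 * ⟪g, (h : H)⟫ - ⟪(h : H), A h⟫) q

variable {X : Type*} [TopologicalSpace X] [MeasurableSpace X] [BorelSpace X]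
  (μ : Measure X) [IsFiniteMeasureOnCompacts μ]

/-- A continuous compactly supported function as an element of `L²`. -/
noncomputable def toL2 (f : C_c(X, ℝ)) : Lp ℝ 2 μ :=
  (f.continuous.memLp_of_hasCompactSupport (p := 2) (μ := μ) f.hasCompactSupport).toLp f

/-- On the open set `U` of pairs of points, the operators `T t`, `t > 0`, have the integral kernels
`p t`, and these are continuous. -/
def IsHeatKernelOn (U : Set (X × X)) (T : ℝ → Lp ℝ 2 μ →L[ℝ] Lp ℝ 2 μ)
    (p : ℝ → X → X → ℝ) : Prop :=
  ContinuousOn (fun z : ℝ × X × X => p z.1 z.2.1 z.2.2) (Ioi 0 ×ˢ U) ∧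
  ∀ t, 0 < t → ∀ f g : C_c(X, ℝ), tsupport f ×ˢ tsupport g ⊆ U →
    ⟪toL2 μ f, T t (toL2 μ g)⟫ = ∫ a, ∫ b, f a * p t a b * g b ∂μ ∂μ

/-- On the open set `U` of pairs of points, the operator `S A⁻¹ S` (`S` a bounded self-adjoint
operator) has the continuous integral kernel `K`. The inverse is understood in the sense of
quadratic forms, since `A⁻¹` may be unbounded; the bilinear form of `S A⁻¹ S` is obtained from its
quadratic form `f ↦ ‖A^{-1/2} S f‖²` by polarization. -/
def IsInvKernelOn (U : Set (X × X)) (A : Lp ℝ 2 μ →ₗ.[ℝ] Lp ℝ 2 μ)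
    (S : Lp ℝ 2 μ →L[ℝ] Lp ℝ 2 μ) (K : X → X → ℝ) : Prop :=
  ContinuousOn (fun z : X × X => K z.1 z.2) U ∧
  ∀ f g : C_c(X, ℝ), tsupport f ×ˢ tsupport g ⊆ U →
    ∃ q₁ q₂ : ℝ, IsInvForm A (S (toL2 μ f + toL2 μ g)) q₁ ∧
      IsInvForm A (S (toL2 μ f - toL2 μ g)) q₂ ∧
      (q₁ - q₂) / 4 = ∫ a, ∫ b, f a * K a b * g b ∂μ ∂μ

end Operators

/-! ### Amplitudes -/

namespace CombMap

variable {n : ℕ} {D : Type*} [Fintype D] (G : CombMap n D)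
  {X : Type*} [MeasurableSpace X] (V : VertexKernels X)

/-- The reference measure for the integration over all positions of internal half-edges. -/
noncomputable def posMeasure : Measure (G.Config X) :=
  Measure.pi fun v : G.Internal => V.ref (G.deg v.1)

/-- The integrand of the Feynman amplitude: a factor `C` for every edge and a factor `-V` for every
internal vertex. -/
noncomputable def feynmanIntegrand (C : X → X → ℝ) (ℓ : G.Labelling) (x : Fin n → X)
    (y : G.Config X) : ℝ :=
  (∏ e ∈ G.edges, C (G.pos ℓ x y (Quot.out e).1) (G.pos ℓ x y (Quot.out e).2)) *
    ∏ v : G.Internal, -(V.dens (G.deg v.1) (y v))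

/-- The Feynman amplitude. -/
noncomputable def feynmanAmplitude (C : X → X → ℝ) (ℓ : G.Labelling) (x : Fin n → X) : ℝ :=
  ∫ y, G.feynmanIntegrand V C ℓ x y ∂(G.posMeasure V)

variable {G}

/-- The integrand of the stochastic amplitude at internal times `z.1` and positions `z.2`: a tree
propagator `θ(t_v - t_w) p(t_v - t_w)` for every forest edge `(v^h, w¹)`, with `v` the parent of
`w`, a noise propagator for every other edge, and a factor `-V` for every internal vertex. -/
noncomputable def stochasticIntegrand (p N : ℝ → X → X → ℝ) (F : G.SpanningForest) (t : ℝ)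
    (x : Fin n → X) (z : (G.Internal → ℝ) × G.Config X) : ℝ :=
  open Classical in
  (∏ w : G.Internal,
    if G.time t z.1 w.1 < G.time t z.1 (G.parent F.1 w.1) then
      p (G.time t z.1 (G.parent F.1 w.1) - G.time t z.1 w.1)
        (G.pos F.1 x z.2 (G.α (F.1.1 w))) (G.pos F.1 x z.2 (F.1.1 w))
    else 0) *
  (∏ e ∈ G.edges \ F.edges,
    N |G.time t z.1 (G.vertex (Quot.out e).1) - G.time t z.1 (G.vertex (Quot.out e).2)|
      (G.pos F.1 x z.2 (Quot.out e).1) (G.pos F.1 x z.2 (Quot.out e).2)) *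
  ∏ v : G.Internal, -(V.dens (G.deg v.1) (z.2 v))

/-- The stochastic amplitude, all external fictitious times being equal to `t`. -/
noncomputable def stochasticAmplitude (p N : ℝ → X → X → ℝ) (F : G.SpanningForest) (t : ℝ)
    (x : Fin n → X) : ℝ :=
  ∫ s : G.Internal → ℝ, ∫ y, stochasticIntegrand V p N F t x (s, y) ∂(G.posMeasure V)

end CombMap

/-! ### The semigroup generated by a positive self-adjoint operator -/

namespace IsHeatSemigroup

variable {H : Type*} [NormedAddCommGroup H] [InnerProductSpace ℝ H]
  {A : H →ₗ.[ℝ] H} {T : ℝ → H →L[ℝ] H}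

/-! Every propagator is a superposition over a length: `C = ∫₀^∞ p τ dτ` and `N u = ∫_u^∞ p τ dτ`.
At fixed positions, the product of the factors `C` is therefore an integral over one independent
positive length `u e` per edge. Read these lengths as a metric on the graph and give every vertex
the time `t` minus its distance to the external vertices. For almost all lengths the shortest paths
single out one spanning forest: along its edges the time difference equals the length, along every
other edge it is strictly smaller. So the orthant of lengths is cut, up to a null set, into one
region per forest (`exists_spanningForest` for covering, `spanningForest_unique` for disjointness).
On the region of `F` the lengths of the forest edges are exchanged for the internal times, an affine
change of variables with Jacobian `±1` (`abs_det_parentShift_sub_one`); the other lengths range over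
`(|t_v - t_w|, ∞)` and integrate to noise propagators. The result is the pointwise identity
`prod_integral_eq_sum_treeIntegrand`.

The analytic input is that `e^{-uA} A⁻¹` has the tail integral of the heat kernel as its kernel.
`IsHeatSemigroup.invForm` shows that the Legendre transform of the form of `A` is `∫₀^∞ ⟪g, T s g⟫
ds`; polarization, Fubini and `kernel_eq_of_integral_eq` turn this into an equality of continuous
functions on `U`.

For convergence, the same identity applied to `|p|` has nonnegative terms, so each forest is
dominated by the product of the `|C|`. Conversely, if all stochastic integrands are integrable,
Fubini allows the pointwise identity to be integrated over the positions. Each forest numbers the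
half-edges in its own way; cyclic symmetry makes this harmless (`exists_relabelling`). -/

theorem comm_apply (hT : IsHeatSemigroup A T) {s t : ℝ} (hs : 0 ≤ s) (ht : 0 ≤ t) (f : H) :
    T s (T t f) = T t (T s f) := by
  have h1 := hT.add s t hs ht
  have h2 := hT.add t s ht hs
  rw [add_comm t s, h1] at h2
  exact DFunLike.congr_fun h2 f

theorem add_apply (hT : IsHeatSemigroup A T) {s t : ℝ} (hs : 0 ≤ s) (ht : 0 ≤ t) (f : H) :
    T (s + t) f = T s (T t f) := by
  rw [hT.add s t hs ht]; rfl

/-- Nothing is known about `T` at negative times. Clamping the time gives an orbit continuous on all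
of `ℝ`, to which interval integrals and the fundamental theorem apply directly. -/
theorem continuous_max (hT : IsHeatSemigroup A T) (f : H) :
    Continuous fun t => T (max t 0) f :=
  (hT.continuousOn f).comp_continuous (by fun_prop) fun _ => mem_Ici.2 (le_max_right _ _)

theorem mem_graph (hT : IsHeatSemigroup A T) {t : ℝ} (ht : 0 ≤ t) {f g : H}
    (hfg : (f, g) ∈ A.graph) : (T t f, T t g) ∈ A.graph := by
  rw [hT.generator] at hfg ⊢
  have h := (T t).hasFDerivAt.comp_hasDerivWithinAt 0 hfg
  rw [map_neg] at h
  exact h.congr (fun s hs => hT.comm_apply hs ht f) (hT.comm_apply le_rfl ht f)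

theorem hasDerivWithinAt_Ici (hT : IsHeatSemigroup A T) {t : ℝ} (ht : 0 ≤ t) {f g : H}
    (hfg : (f, g) ∈ A.graph) : HasDerivWithinAt (fun s => T s f) (-(T t g)) (Ici t) t := by
  have h := (hT.generator _ _).1 (hT.mem_graph ht hfg)
  have h1 : HasDerivWithinAt (fun s : ℝ => s - t) 1 (Ici t) t :=
    ((hasDerivAt_id t).sub_const t).hasDerivWithinAt
  have h2 := HasDerivWithinAt.scomp (t' := Ici (0 : ℝ)) t (by simpa using h) h1
    (fun s hs => by simpa using hs)
  rw [one_smul] at h2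
  refine h2.congr (fun s hs => ?_) ?_
  · simp only [Function.comp]
    rw [← hT.add_apply (by simpa using hs) ht, sub_add_cancel]
  · simp [hT.zero]

theorem form_nonneg (hpos : IsPosDefOp A) (k : A.domain) : 0 ≤ ⟪(k : H), A k⟫ := by
  by_cases hk : k = 0
  · simp [hk]
  · exact (hpos k hk).le

variable [CompleteSpace H]

/-- The generator provides right derivatives only. A continuous function with continuous right
derivative is its integral, and this integrated form yields the two-sided derivative at positive
times. -/
theorem integral_eq (hT : IsHeatSemigroup A T) {t : ℝ} (ht : 0 ≤ t) {f g : H}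
    (hfg : (f, g) ∈ A.graph) : T t f = f - ∫ s in (0 : ℝ)..t, T (max s 0) g := by
  have h := intervalIntegral.integral_eq_sub_of_hasDeriv_right_of_le (f := fun s => T s f)
    (f' := fun s => -(T (max s 0) g)) ht ((hT.continuousOn f).mono Icc_subset_Ici_self)
    (fun s hs => by
      rw [max_eq_left hs.1.le]
      exact (hT.hasDerivWithinAt_Ici hs.1.le hfg).mono Ioi_subset_Ici_self)
    (hT.continuous_max g).neg.continuousOn.intervalIntegrable
  rw [intervalIntegral.integral_neg, hT.zero] at h
  simp only [one_apply_eq_self] at h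
  rw [sub_eq_add_neg, h, add_sub_cancel]

theorem hasDerivAt (hT : IsHeatSemigroup A T) {t : ℝ} (ht : 0 < t) {f g : H}
    (hfg : (f, g) ∈ A.graph) : HasDerivAt (fun s => T s f) (-(T t g)) t := by
  have h := intervalIntegral.integral_hasDerivAt_right (a := 0) (b := t)
    (hT.continuous_max g).continuousOn.intervalIntegrable
    ((hT.continuous_max g).stronglyMeasurableAtFilter _ _) (hT.continuous_max g).continuousAt
  rw [max_eq_left ht.le] at h
  refine (h.const_sub f).congr_of_eventuallyEq ?_
  filter_upwards [Ioi_mem_nhds ht] with s hs using hT.integral_eq hs.le hfg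

/-- The quantity `⟪T (t - s) f, T s g⟫` is constant in `s`: its right derivative vanishes by the
symmetry of `A`. Its values at `s = 0` and `s = t` are the two sides. -/
theorem inner_symm_of_mem_graph (hT : IsHeatSemigroup A T) (hA : IsSelfAdjoint A) {t : ℝ}
    (ht : 0 ≤ t) {f f' g g' : H} (hf : (f, f') ∈ A.graph) (hg : (g, g') ∈ A.graph) :
    ⟪T t f, g⟫ = ⟪f, T t g⟫ := by
  have hsymm : ∀ {a a' b b' : H}, (a, a') ∈ A.graph → (b, b') ∈ A.graph → ⟪a', b⟫ = ⟪a, b'⟫ := by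
    intro a a' b b' ha hb
    obtain ⟨x, hx, hx'⟩ := A.mem_graph_iff.1 ha
    obtain ⟨y, hy, hy'⟩ := A.mem_graph_iff.1 hb
    have h := LinearPMap.adjoint_isFormalAdjoint hA.dense_domain
    rw [LinearPMap.isSelfAdjoint_def.1 hA] at h
    simpa only [hx', hy', hx, hy] using h x y
  have hc := constant_of_has_deriv_right_zero (f := fun s => ⟪T (t - s) f, T s g⟫) (a := 0) (b := t)
    (ContinuousOn.inner ((hT.continuousOn f).comp (by fun_prop) fun s hs => by simpa using hs.2)
      ((hT.continuousOn g).mono Icc_subset_Ici_self)) (fun s hs => by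
        have h1 := (HasDerivAt.comp_const_sub t s
          (hT.hasDerivAt (sub_pos.2 hs.2) hf)).hasDerivWithinAt (s := Ici s)
        have h2 := h1.inner ℝ (hT.hasDerivWithinAt_Ici hs.1 hg)
        have h3 := hsymm (hT.mem_graph (sub_nonneg.2 hs.2.le) hf) (hT.mem_graph hs.1 hg)
        rw [neg_neg, inner_neg_right, h3, neg_add_cancel] at h2
        exact h2)
    t ⟨ht, le_rfl⟩
  simp only [sub_self, sub_zero, hT.zero, one_apply_eq_self] at hc
  exact hc.symm

/-- The semigroup generated by a self-adjoint operator is symmetric. -/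
theorem inner_symm (hT : IsHeatSemigroup A T) (hA : IsSelfAdjoint A) {t : ℝ} (ht : 0 ≤ t)
    (f g : H) : ⟪T t f, g⟫ = ⟪f, T t g⟫ := by
  have hd := hA.dense_domain
  have h1 : ∀ a : A.domain, (fun g => ⟪T t (a : H), g⟫) = fun g => ⟪(a : H), T t g⟫ := fun a =>
    Continuous.ext_on hd (by fun_prop) (by fun_prop) fun b hb =>
      hT.inner_symm_of_mem_graph hA ht (A.mem_graph a) (A.mem_graph ⟨b, hb⟩)
  have h2 : (fun f => ⟪T t f, g⟫) = fun f => ⟪f, T t g⟫ :=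
    Continuous.ext_on hd (by fun_prop) (by fun_prop) fun a ha => congr_fun (h1 ⟨a, ha⟩) g
  exact congr_fun h2 f

/-- The semigroup generated by a positive self-adjoint operator consists of contractions. -/
theorem norm_apply_le (hT : IsHeatSemigroup A T) (hA : IsSelfAdjoint A) (hpos : IsPosDefOp A)
    {t : ℝ} (ht : 0 ≤ t) (f : H) : ‖T t f‖ ≤ ‖f‖ := by
  -- On the domain, the derivative of `‖T s a‖²` is `-2⟪T s a, A (T s a)⟫ ≤ 0`; density of the
  -- domain does the rest.
  have key : ∀ a ∈ (A.domain : Set H), ‖T t a‖ ≤ ‖a‖ := by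
    intro a ha
    have hder : ∀ s ∈ Ioi (0 : ℝ), HasDerivAt (fun s => ⟪T s a, T s a⟫)
        (⟪T s a, -(T s (A ⟨a, ha⟩))⟫ + ⟪-(T s (A ⟨a, ha⟩)), T s a⟫) s := fun s hs =>
      (hT.hasDerivAt hs (A.mem_graph ⟨a, ha⟩)).inner ℝ (hT.hasDerivAt hs (A.mem_graph ⟨a, ha⟩))
    have hanti : AntitoneOn (fun s => ⟪T s a, T s a⟫) (Ici 0) := by
      refine antitoneOn_of_deriv_nonpos (convex_Ici 0)
        ((hT.continuousOn a).inner (hT.continuousOn a)) ?_ ?_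
      · rw [interior_Ici]
        exact fun s hs => (hder s hs).differentiableAt.differentiableWithinAt
      · rw [interior_Ici]
        intro s hs
        rw [(hder s hs).deriv, inner_neg_right, inner_neg_left, real_inner_comm (T s a)]
        obtain ⟨x, hx, hx'⟩ := A.mem_graph_iff.1 (hT.mem_graph (le_of_lt hs) (A.mem_graph ⟨a, ha⟩))
        have := form_nonneg hpos x
        rw [hx, hx', real_inner_comm] at this
        dsimp only at this
        linarith [real_inner_comm (T s a) (T s (A ⟨a, ha⟩))]
    have h := hanti (mem_Ici.2 le_rfl) (mem_Ici.2 ht) ht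
    simp only [hT.zero, real_inner_self_eq_norm_sq, one_apply_eq_self] at h
    exact le_of_sq_le_sq h (norm_nonneg _)
  have hcl : IsClosed {f : H | ‖T t f‖ ≤ ‖f‖} :=
    isClosed_le (by fun_prop) (by fun_prop)
  have := hcl.closure_subset_iff.2 key
  rw [hA.dense_domain.closure_eq] at this
  exact this (mem_univ f)

/-- `A ∫₀ᴿ e^{-sA} g ds = g - e^{-RA} g`. -/
theorem integral_mem_graph (hT : IsHeatSemigroup A T) {R : ℝ} (hR : 0 ≤ R) (g : H) :
    (∫ s in (0 : ℝ)..R, T (max s 0) g, g - T R g) ∈ A.graph := by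
  have hc := hT.continuous_max g
  have hi : ∀ a b : ℝ, IntervalIntegrable (fun s => T (max s 0) g) volume a b :=
    fun a b => hc.continuousOn.intervalIntegrable
  rw [hT.generator]
  have hd : ∀ b : ℝ, HasDerivAt (fun u => ∫ s in (0 : ℝ)..u, T (max s 0) g) (T (max b 0) g) b :=
    fun b => intervalIntegral.integral_hasDerivAt_right (hi _ _)
      (hc.stronglyMeasurableAtFilter _ _) hc.continuousAt
  have h1 : HasDerivAt (fun u => ∫ s in (0 : ℝ)..(R + u), T (max s 0) g) (T R g) 0 := by
    have := HasDerivAt.comp_const_add R 0 (hd (R + 0))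
    simpa [hR] using this
  have h2 := hd 0
  rw [max_self, hT.zero, one_apply_eq_self] at h2
  have h3 := (h1.sub h2).hasDerivWithinAt (s := Ici 0)
  rw [neg_sub]
  -- `T u` moves the window `[0, R]` to `[u, R + u]`. Only the endpoints depend on `u`, so the
  -- derivative at `0` exists for every `g`, in the domain or not.
  have hk : ∀ u ∈ Ici (0 : ℝ), T u (∫ s in (0 : ℝ)..R, T (max s 0) g) =
      (∫ s in (0 : ℝ)..(R + u), T (max s 0) g) - ∫ s in (0 : ℝ)..u, T (max s 0) g := by
    intro u hu
    rw [← ContinuousLinearMap.intervalIntegral_comp_comm (T u) (hi _ _),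
      intervalIntegral.integral_interval_sub_left (hi _ _) (hi _ _)]
    have : ∫ s in u..(R + u), T (max s 0) g = ∫ s in (0 : ℝ)..R, T (max (s + u) 0) g := by
      rw [intervalIntegral.integral_comp_add_right (fun s => T (max s 0) g), zero_add]
    rw [this]
    refine intervalIntegral.integral_congr fun s hs => ?_
    rw [uIcc_of_le hR] at hs
    rw [max_eq_left hs.1, max_eq_left (add_nonneg hs.1 hu), ← hT.add_apply hu hs.1, add_comm]
  have h4 : HasDerivWithinAt (fun u => T u (∫ s in (0 : ℝ)..R, T (max s 0) g)) (T R g - g)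
      (Ici 0) 0 := h3.congr hk (hk 0 (mem_Ici.2 le_rfl))
  exact h4

theorem inner_self_eq (hT : IsHeatSemigroup A T) (hA : IsSelfAdjoint A) {s : ℝ} (hs : 0 ≤ s)
    (g : H) : ⟪g, T s g⟫ = ‖T (s / 2) g‖ ^ 2 := by
  rw [← real_inner_self_eq_norm_sq, hT.inner_symm hA (by positivity),
    ← hT.add_apply (by positivity) (by positivity), add_halves]

/-- The quadratic form of `A⁻¹` is the time integral of that of `e^{-sA}`. -/
theorem invForm (hT : IsHeatSemigroup A T) (hA : IsSelfAdjoint A) (hpos : IsPosDefOp A)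
    {g : H} {q : ℝ} (hq : IsInvForm A g q) :
    IntegrableOn (fun s => ⟪g, T s g⟫) (Ioi 0) ∧ ∫ s in Ioi (0 : ℝ), ⟪g, T s g⟫ = q := by
  set φ : ℝ → ℝ := fun s => ⟪g, T (max s 0) g⟫ with hφ
  have hφc : Continuous φ := continuous_const.inner (hT.continuous_max g)
  have hφ0 : ∀ s, 0 ≤ φ s := fun s => by
    rw [hφ]; dsimp only
    rw [hT.inner_self_eq hA (le_max_right _ _)]; positivity
  have hφe : ∀ s, 0 ≤ s → φ s = ⟪g, T s g⟫ := fun s hs => by rw [hφ]; simp [hs]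
  have hφi : ∀ a b, IntervalIntegrable φ volume a b := fun a b => hφc.continuousOn.intervalIntegrable
  have hanti : ∀ s t, 0 ≤ s → s ≤ t → φ t ≤ φ s := by
    intro s t hs hst
    rw [hφe s hs, hφe t (hs.trans hst), hT.inner_self_eq hA hs,
      hT.inner_self_eq hA (hs.trans hst)]
    have : T (t / 2) g = T ((t - s) / 2) (T (s / 2) g) := by
      rw [← hT.add_apply (by linarith) (by positivity)]; congr 2; ring
    rw [this]
    gcongr
    exact hT.norm_apply_le hA hpos (by linarith) _
  have hin : ∀ h : H, ∀ R, ⟪h, ∫ s in (0 : ℝ)..R, T (max s 0) g⟫ =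
      ∫ s in (0 : ℝ)..R, ⟪h, T (max s 0) g⟫ := fun h R =>
    ((innerSL ℝ h).intervalIntegral_comp_comm
      (hT.continuous_max g).continuousOn.intervalIntegrable).symm
  have hk : ∀ R, 0 ≤ R → ∃ k : A.domain, (k : H) = ∫ s in (0 : ℝ)..R, T (max s 0) g ∧
      A k = g - T R g := fun R hR => by
    obtain ⟨k, h1, h2⟩ := A.mem_graph_iff.1 (hT.integral_mem_graph hR g)
    exact ⟨k, h1, h2⟩
  have hTR : ∀ R, 0 ≤ R → ⟪T R g, ∫ s in (0 : ℝ)..R, T (max s 0) g⟫ = ∫ s in R..(R + R), φ s := by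
    intro R hR
    have e1 : ∫ s in R..(R + R), φ s = ∫ s in (0 : ℝ)..R, φ (s + R) := by
      rw [intervalIntegral.integral_comp_add_right φ, zero_add]
    rw [hin, e1]
    refine intervalIntegral.integral_congr fun s hs => ?_
    rw [uIcc_of_le hR] at hs
    rw [hφe _ (add_nonneg hs.1 hR), max_eq_left hs.1, hT.inner_symm hA hR, ← hT.add_apply hR hs.1,
      add_comm]
  -- Test vector `k = ∫₀ᴿ T s g ds` in the supremum: since `A k = g - T R g`, its value is `∫₀ᴿ φ +
  -- ∫_R^{2R} φ`.
  have hup : ∀ R, 0 ≤ R → ∫ s in (0 : ℝ)..R, φ s ≤ q := by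
    intro R hR
    obtain ⟨k, hk1, hk2⟩ := hk R hR
    have h := hq.1 ⟨k, rfl⟩
    dsimp only at h
    have e2 := intervalIntegral.integral_add_adjacent_intervals (hφi 0 R) (hφi R (R + R))
    have e3 : 0 ≤ ∫ s in R..(R + R), φ s :=
      intervalIntegral.integral_nonneg (by linarith) fun s _ => hφ0 s
    have e4 := hTR R hR
    have e5 := hin g R
    rw [hk2, inner_sub_right, real_inner_comm (T R g), real_inner_comm g, hk1, e4, e5] at h
    change 2 * (∫ s in (0 : ℝ)..R, φ s) - ((∫ s in (0 : ℝ)..R, φ s) - _) ≤ q at h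
    linarith
  have hint : IntegrableOn φ (Ioi 0) := by
    refine integrableOn_Ioi_of_intervalIntegral_norm_bounded (b := fun R : ℝ => R) (l := atTop) q 0
      (fun R => (hφc.integrableOn_Icc (a := 0) (b := R)).mono_set Ioc_subset_Icc_self) tendsto_id ?_
    filter_upwards [eventually_ge_atTop (0 : ℝ)] with R hR
    simpa only [Real.norm_of_nonneg (hφ0 _)] using hup R hR
  have heq : EqOn φ (fun s => ⟪g, T s g⟫) (Ioi 0) := fun s hs => hφe s (le_of_lt hs)
  have hlim := intervalIntegral_tendsto_integral_Ioi 0 hint tendsto_id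
  -- A decreasing `φ` satisfies `R φ(R) ≤ ∫₀ᴿ φ ≤ q`.
  have hφlim : Tendsto φ atTop (𝓝 0) := by
    refine squeeze_zero' (g := fun R => q / R) (Eventually.of_forall hφ0) ?_
      (tendsto_const_nhds.div_atTop tendsto_id)
    filter_upwards [eventually_gt_atTop (0 : ℝ)] with R hR
    rw [le_div_iff₀ hR]
    refine le_trans ?_ (hup R hR.le)
    have := intervalIntegral.integral_mono_on hR.le (intervalIntegrable_const (c := φ R)) (hφi 0 R)
      fun s hs => hanti s R hs.1 hs.2
    simpa [mul_comm] using this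
  refine ⟨hint.congr_fun heq measurableSet_Ioi, ?_⟩
  rw [← setIntegral_congr_fun measurableSet_Ioi heq]
  refine le_antisymm (le_of_tendsto hlim ?_) (hq.2 ?_)
  · filter_upwards [eventually_ge_atTop (0 : ℝ)] with R hR using hup R hR
  rintro _ ⟨h, rfl⟩
  dsimp only
  -- Cauchy–Schwarz, with `‖T R g‖² = φ (2R)`.
  have hTlim : Tendsto (fun R => ⟪(h : H), T R g⟫) atTop (𝓝 0) := by
    have h1 : Tendsto (fun R => ‖(h : H)‖ * √(φ (2 * R))) atTop (𝓝 (‖(h : H)‖ * √0)) :=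
      ((hφlim.comp (tendsto_id.const_mul_atTop (by norm_num : (0 : ℝ) < 2))).sqrt).const_mul _
    rw [Real.sqrt_zero, mul_zero] at h1
    refine squeeze_zero_norm' ?_ h1
    filter_upwards [eventually_ge_atTop (0 : ℝ)] with R hR
    rw [hφe _ (by positivity), hT.inner_self_eq hA (by positivity),
      mul_div_cancel_left₀ _ (by norm_num), Real.sqrt_sq (norm_nonneg _)]
    exact norm_inner_le_norm _ _
  have hlim2 : Tendsto (fun R => 2 * (⟪g, (h : H)⟫ - ⟪(h : H), T R g⟫) - ⟪(h : H), A h⟫) atTop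
      (𝓝 (2 * (⟪g, (h : H)⟫ - 0) - ⟪(h : H), A h⟫)) :=
    (((hTlim.const_sub _).const_mul 2)).sub_const _
  rw [sub_zero] at hlim2
  refine le_of_tendsto_of_tendsto hlim2 hlim ?_
  filter_upwards [eventually_ge_atTop (0 : ℝ)] with R hR
  obtain ⟨k, hk1, hk2⟩ := hk R hR
  have hsa : ⟪(k : H), A h⟫ = ⟪A k, (h : H)⟫ := by
    have := LinearPMap.adjoint_isFormalAdjoint hA.dense_domain
    rw [LinearPMap.isSelfAdjoint_def.1 hA] at this
    exact (this k h).symm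
  -- Completing the square: positivity at `h - k` gives `2⟪h, A k⟫ - ⟪h, A h⟫ ≤ ⟪k, A k⟫ = ∫₀ᴿ φ -
  -- ∫_R^{2R} φ`, and `A k` differs from `g` by `T R g`, whose pairing with `h` tends to zero.
  have hf := form_nonneg hpos (h - k)
  rw [LinearPMap.map_sub] at hf
  have e0 : ((h - k : A.domain) : H) = h - k := rfl
  rw [e0, inner_sub_left, inner_sub_right, inner_sub_right, hsa, hk2] at hf
  have e3 : 0 ≤ ∫ s in R..(R + R), φ s :=
    intervalIntegral.integral_nonneg (by linarith) fun s _ => hφ0 s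
  rw [← hTR R hR, ← hk1, real_inner_comm] at e3
  have e5 : ⟪g, (k : H)⟫ = ∫ s in (0 : ℝ)..R, φ s := by rw [hk1, hin g R]
  rw [id, ← e5]
  simp only [inner_sub_left, inner_sub_right, real_inner_comm (h : H) (T R g),
    real_inner_comm (h : H) g, real_inner_comm (k : H) g] at hf e3 ⊢
  linarith [real_inner_comm (h : H) (T R g), real_inner_comm (h : H) g, real_inner_comm (k : H) g]

end IsHeatSemigroup

/-! ### Integral kernels -/

section Kernels

variable {X : Type*} [TopologicalSpace X]

theorem exists_compactlySupported_bump [LocallyCompactSpace X] [T2Space X] {a : X} {W : Set X}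
    (hW : IsOpen W) (ha : a ∈ W) :
    ∃ f : C_c(X, ℝ), f a = 1 ∧ (∀ x, 0 ≤ f x) ∧ tsupport f ⊆ W := by
  obtain ⟨K, hK, haK, hKW⟩ := exists_compact_subset hW ha
  obtain ⟨f, h1, h0, hc, hf⟩ := exists_continuous_one_zero_of_isCompact
    (isCompact_singleton (x := a)) isOpen_interior.isClosed_compl
    (disjoint_compl_right_iff_subset.2 (singleton_subset_iff.2 haK))
  refine ⟨⟨f, hc⟩, h1 rfl, fun x => (hf x).1, ?_⟩
  refine subset_trans (closure_minimal (fun x hx => ?_) hK.isClosed) hKW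
  by_contra hxK
  exact hx (h0 fun hx' => hxK (interior_subset hx'))

theorem tsupport_mul_kernel_subset (f g : C_c(X, ℝ)) (K : X → X → ℝ) :
    tsupport (fun z : X × X => f z.1 * K z.1 z.2 * g z.2) ⊆ tsupport f ×ˢ tsupport g := by
  refine closure_minimal (fun z hz => ?_) ((isClosed_tsupport _).prod (isClosed_tsupport _))
  simp only [Function.mem_support, ne_eq, mul_eq_zero, not_or] at hz
  exact ⟨subset_tsupport _ hz.1.1, subset_tsupport _ hz.2⟩

/-- The values of `K` off `U` are arbitrary, but the topological support of the product lies in the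
open set `U`, where all factors are continuous. -/
theorem continuous_mul_kernel {U : Set (X × X)} (hU : IsOpen U) {K : X → X → ℝ}
    (hK : ContinuousOn (fun z : X × X => K z.1 z.2) U) {f g : C_c(X, ℝ)}
    (hfg : tsupport f ×ˢ tsupport g ⊆ U) :
    Continuous fun z : X × X => f z.1 * K z.1 z.2 * g z.2 := by
  refine ContinuousOn.continuous_of_tsupport_subset (s := U) ?_ hU
    ((tsupport_mul_kernel_subset f g K).trans hfg)
  exact ((f.continuous.comp continuous_fst).continuousOn.mul hK).mul
    (g.continuous.comp continuous_snd).continuousOn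

theorem hasCompactSupport_mul_kernel (f g : C_c(X, ℝ)) (K : X → X → ℝ) :
    HasCompactSupport fun z : X × X => f z.1 * K z.1 z.2 * g z.2 :=
  (f.hasCompactSupport.prod g.hasCompactSupport).of_isClosed_subset (isClosed_tsupport _)
    (tsupport_mul_kernel_subset f g K)

variable [LocallyCompactSpace X] [T2Space X] [SecondCountableTopology X] [MeasurableSpace X]
  [BorelSpace X] {μ : Measure X} [IsFiniteMeasureOnCompacts μ]

omit [LocallyCompactSpace X] [T2Space X] in
theorem integrable_mul_kernel {U : Set (X × X)} (hU : IsOpen U) {K : X → X → ℝ}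
    (hK : ContinuousOn (fun z : X × X => K z.1 z.2) U) {f g : C_c(X, ℝ)}
    (hfg : tsupport f ×ˢ tsupport g ⊆ U) :
    Integrable (fun z : X × X => f z.1 * K z.1 z.2 * g z.2) (μ.prod μ) :=
  (continuous_mul_kernel hU hK hfg).integrable_of_hasCompactSupport
    (hasCompactSupport_mul_kernel f g K)

/-- A continuous kernel on an open set of pairs of points is determined by its bilinear form. -/
theorem kernel_le_of_integral_eq [μ.IsOpenPosMeasure] {U : Set (X × X)} (hU : IsOpen U)
    {K₁ K₂ : X → X → ℝ}
    (h₁ : ContinuousOn (fun z : X × X => K₁ z.1 z.2) U)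
    (h₂ : ContinuousOn (fun z : X × X => K₂ z.1 z.2) U)
    (h : ∀ f g : C_c(X, ℝ), tsupport f ×ˢ tsupport g ⊆ U →
      ∫ a, ∫ b, f a * K₁ a b * g b ∂μ ∂μ = ∫ a, ∫ b, f a * K₂ a b * g b ∂μ ∂μ)
    {a b : X} (hab : (a, b) ∈ U) : K₂ a b ≤ K₁ a b := by
  -- A strict inequality at `(a, b)` persists on a product neighbourhood inside `U`. Bumps supported
  -- in its two factors make the form of `K₂ - K₁` strictly positive, since `μ` charges open sets.
  by_contra! hlt
  have hW : IsOpen (U ∩ (fun z : X × X => K₂ z.1 z.2 - K₁ z.1 z.2) ⁻¹' Ioi 0) :=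
    (h₂.sub h₁).isOpen_inter_preimage hU isOpen_Ioi
  obtain ⟨W₁, W₂, hW₁, hW₂, ha, hb, hsub⟩ := isOpen_prod_iff.1 hW a b ⟨hab, sub_pos.2 hlt⟩
  obtain ⟨f, hfa, hf0, hfW⟩ := exists_compactlySupported_bump hW₁ ha
  obtain ⟨g, hgb, hg0, hgW⟩ := exists_compactlySupported_bump hW₂ hb
  have hfg' := (prod_mono hfW hgW).trans hsub
  have hfg : tsupport f ×ˢ tsupport g ⊆ U := hfg'.trans inter_subset_left
  have hnn : ∀ z : X × X, 0 ≤ f z.1 * (K₂ z.1 z.2 - K₁ z.1 z.2) * g z.2 := fun z => by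
    by_cases hz : z ∈ tsupport f ×ˢ tsupport g
    · have hz' : 0 < K₂ z.1 z.2 - K₁ z.1 z.2 := (hfg' hz).2
      exact mul_nonneg (mul_nonneg (hf0 _) hz'.le) (hg0 _)
    · exact (image_eq_zero_of_notMem_tsupport fun hz' => hz
        (tsupport_mul_kernel_subset f g (fun a b => K₂ a b - K₁ a b) hz')).ge
  have hne : f a * (K₂ a b - K₁ a b) * g b ≠ 0 := by
    rw [hfa, hgb, one_mul, mul_one]; exact (sub_pos.2 hlt).ne'
  have hcont := continuous_mul_kernel hU (K := fun a b => K₂ a b - K₁ a b) (h₂.sub h₁) hfg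
  have hpos : 0 < ∫ z : X × X, f z.1 * (K₂ z.1 z.2 - K₁ z.1 z.2) * g z.2 ∂μ.prod μ :=
    hcont.integral_pos_of_hasCompactSupport_nonneg_nonzero
      (hasCompactSupport_mul_kernel f g fun a b => K₂ a b - K₁ a b) hnn (x := (a, b)) hne
  have e : ∀ z : X × X, f z.1 * (K₂ z.1 z.2 - K₁ z.1 z.2) * g z.2 =
      f z.1 * K₂ z.1 z.2 * g z.2 - f z.1 * K₁ z.1 z.2 * g z.2 := fun z => by ring
  simp only [e] at hpos
  rw [integral_sub (integrable_mul_kernel hU h₂ hfg) (integrable_mul_kernel hU h₁ hfg),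
    integral_prod _ (integrable_mul_kernel hU h₂ hfg),
    integral_prod _ (integrable_mul_kernel hU h₁ hfg), h f g hfg, sub_self] at hpos
  exact hpos.false

theorem kernel_eq_of_integral_eq [μ.IsOpenPosMeasure] {U : Set (X × X)} (hU : IsOpen U)
    {K₁ K₂ : X → X → ℝ}
    (h₁ : ContinuousOn (fun z : X × X => K₁ z.1 z.2) U)
    (h₂ : ContinuousOn (fun z : X × X => K₂ z.1 z.2) U)
    (h : ∀ f g : C_c(X, ℝ), tsupport f ×ˢ tsupport g ⊆ U →
      ∫ a, ∫ b, f a * K₁ a b * g b ∂μ ∂μ = ∫ a, ∫ b, f a * K₂ a b * g b ∂μ ∂μ)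
    {a b : X} (hab : (a, b) ∈ U) : K₁ a b = K₂ a b :=
  le_antisymm (kernel_le_of_integral_eq hU h₂ h₁ (fun f g hfg => (h f g hfg).symm) hab)
    (kernel_le_of_integral_eq hU h₁ h₂ h hab)

/-- If `f` is continuous and the integral of its absolute value depends continuously on the
parameter, then so do the integrals of `f` over subsets. -/
theorem continuousOn_setIntegral_of_continuousOn_integral_abs {Z : Type*} [TopologicalSpace Z]
    [SecondCountableTopology Z] {U : Set Z} {f : ℝ → Z → ℝ}
    (hf : ContinuousOn (fun z : ℝ × Z => f z.1 z.2) (Ioi 0 ×ˢ U))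
    (hint : ∀ z ∈ U, IntegrableOn (fun s => f s z) (Ioi 0))
    (hcont : ContinuousOn (fun z => ∫ s in Ioi (0 : ℝ), |f s z|) U) {S : Set ℝ} (hS : S ⊆ Ioi 0) :
    ContinuousOn (fun z => ∫ s in S, f s z) U := by
  intro z₀ hz₀
  have hev : ∀ᶠ z in 𝓝[U] z₀, z ∈ U := self_mem_nhdsWithin
  have hlim : ∀ s ∈ Ioi (0 : ℝ), Tendsto (fun z => f s z) (𝓝[U] z₀) (𝓝 (f s z₀)) := fun s hs =>
    (hf.comp (f := fun z => (s, z)) (by fun_prop) fun z hz => ⟨hs, hz⟩) z₀ hz₀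
  -- Scheffé's argument: this integrand lies between `0` and `2 |f s z₀|`, a bound independent of
  -- `z`. Subtracting its limit from that of `∫ |f s z|`, which is `hcont`, gives convergence in
  -- `L¹`.
  have h1 : Tendsto (fun z => ∫ s in Ioi (0 : ℝ), (|f s z| + |f s z₀| - |f s z - f s z₀|))
      (𝓝[U] z₀) (𝓝 (∫ s in Ioi (0 : ℝ), (|f s z₀| + |f s z₀| - |f s z₀ - f s z₀|))) := by
    refine tendsto_integral_filter_of_dominated_convergence (fun s => 2 * |f s z₀|) ?_ ?_
      ((hint z₀ hz₀).abs.const_mul 2) ?_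
    · filter_upwards [hev] with z hz
      exact (((hint z hz).abs.add (hint z₀ hz₀).abs).sub
        ((hint z hz).sub (hint z₀ hz₀)).abs).aestronglyMeasurable
    · refine Eventually.of_forall fun z => Eventually.of_forall fun s => ?_
      have e1 := abs_sub (f s z) (f s z₀)
      have e2 := abs_sub_abs_le_abs_sub (f s z) (f s z₀)
      rw [Real.norm_of_nonneg (by linarith)]
      linarith
    · refine (ae_restrict_iff' measurableSet_Ioi).2 (Eventually.of_forall fun s hs => ?_)
      have := hlim s hs
      exact (this.abs.add_const _).sub (this.sub_const _).abs
  have h2 : Tendsto (fun z => ∫ s in Ioi (0 : ℝ), |f s z - f s z₀|) (𝓝[U] z₀) (𝓝 0) := by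
    have h3 := ((hcont z₀ hz₀).tendsto.add_const (∫ s in Ioi (0 : ℝ), |f s z₀|)).sub h1
    have e0 : ∫ s in Ioi (0 : ℝ), (|f s z₀| + |f s z₀| - |f s z₀ - f s z₀|) =
        (∫ s in Ioi (0 : ℝ), |f s z₀|) + ∫ s in Ioi (0 : ℝ), |f s z₀| := by
      rw [← integral_add (hint z₀ hz₀).abs (hint z₀ hz₀).abs]; simp
    rw [e0, sub_self] at h3
    refine h3.congr' ?_
    filter_upwards [hev] with z hz
    have i1 : IntegrableOn (fun s => |f s z| + |f s z₀|) (Ioi 0) :=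
      (hint z hz).abs.add (hint z₀ hz₀).abs
    have i2 : IntegrableOn (fun s => |f s z - f s z₀|) (Ioi 0) :=
      ((hint z hz).sub (hint z₀ hz₀)).abs
    rw [integral_sub i1 i2,
      integral_add (hint z hz).abs (hint z₀ hz₀).abs]
    simp
  rw [ContinuousWithinAt, tendsto_iff_norm_sub_tendsto_zero]
  refine squeeze_zero' (Eventually.of_forall fun _ => norm_nonneg _) ?_ h2
  filter_upwards [hev] with z hz
  have i := (hint z hz).sub (hint z₀ hz₀)
  rw [← integral_sub ((hint z hz).mono_set hS) ((hint z₀ hz₀).mono_set hS)]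
  refine (norm_integral_le_integral_norm _).trans ?_
  exact setIntegral_mono_set i.norm (Eventually.of_forall fun _ => norm_nonneg _)
    (LE.le.eventuallyLE hS)

omit [LocallyCompactSpace X] [T2Space X] in
-- Joint measurability is available only for the extension by zero; it replaces the kernel wherever
-- the values off `U` do not matter.
theorem measurable_indicator_heatKernel {U : Set (X × X)} (hU : IsOpen U) {p : ℝ → X → X → ℝ}
    (hp : ContinuousOn (fun z : ℝ × X × X => p z.1 z.2.1 z.2.2) (Ioi 0 ×ˢ U)) :
    Measurable ((Ioi (0 : ℝ) ×ˢ U).indicator fun z : ℝ × X × X => p z.1 z.2.1 z.2.2) := by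
  classical
  rw [← piecewise_eq_indicator]
  exact hp.measurable_piecewise continuousOn_const (isOpen_Ioi.prod hU).measurableSet

omit [T2Space X] in
/-- Fubini's theorem for the time integral of the bilinear form of a heat kernel. -/
theorem integral_mul_integral_heatKernel {U : Set (X × X)} (hU : IsOpen U) {p : ℝ → X → X → ℝ}
    (hp : ContinuousOn (fun z : ℝ × X × X => p z.1 z.2.1 z.2.2) (Ioi 0 ×ˢ U))
    (hint : ∀ a b, (a, b) ∈ U → IntegrableOn (fun u => p u a b) (Ioi 0))
    (hcont : ContinuousOn (fun z : X × X => ∫ u in Ioi (0 : ℝ), |p u z.1 z.2|) U)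
    {u : ℝ} (hu : 0 ≤ u) {f g : C_c(X, ℝ)} (hfg : tsupport f ×ˢ tsupport g ⊆ U) :
    ∫ a, ∫ b, f a * (∫ s in Ioi u, p s a b) * g b ∂μ ∂μ =
      ∫ s in Ioi u, ∫ a, ∫ b, f a * p s a b * g b ∂μ ∂μ := by
  have hsub : Ioi u ⊆ Ioi 0 := Ioi_subset_Ioi hu
  have hz : ∀ z ∉ U, ∀ c, f z.1 * c * g z.2 = 0 := fun z hz c => by
    by_contra h
    rw [mul_eq_zero, mul_eq_zero, not_or, not_or] at h
    exact hz (hfg ⟨subset_tsupport _ h.1.1, subset_tsupport _ h.2⟩)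
  have hP : ContinuousOn (fun z : X × X => ∫ s in Ioi u, p s z.1 z.2) U :=
    continuousOn_setIntegral_of_continuousOn_integral_abs (Z := X × X) (f := fun s z => p s z.1 z.2) hp
      (fun z hz => hint z.1 z.2 hz) hcont hsub
  have hP' : ContinuousOn (fun z : X × X => ∫ s in Ioi u, |p s z.1 z.2|) U :=
    continuousOn_setIntegral_of_continuousOn_integral_abs (Z := X × X) (f := fun s z => |p s z.1 z.2|) hp.abs
      (fun z hz => (hint z.1 z.2 hz).abs) (by simpa only [abs_abs] using hcont) hsub
  have hF : Integrable (fun y : ℝ × X × X => f y.2.1 * p y.1 y.2.1 y.2.2 * g y.2.2)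
      ((volume.restrict (Ioi u)).prod (μ.prod μ)) := by
    have hmeas : AEStronglyMeasurable
        (fun y : ℝ × X × X => f y.2.1 * p y.1 y.2.1 y.2.2 * g y.2.2)
        ((volume.restrict (Ioi u)).prod (μ.prod μ)) := by
      have hm : Measurable fun y : ℝ × X × X => f y.2.1 *
          ((Ioi (0 : ℝ) ×ˢ U).indicator fun z : ℝ × X × X => p z.1 z.2.1 z.2.2) y * g y.2.2 :=
        ((f.continuous.measurable.comp measurable_snd.fst).mul
          (measurable_indicator_heatKernel hU hp)).mul
          (g.continuous.measurable.comp measurable_snd.snd)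
      refine hm.aestronglyMeasurable.congr ?_
      have : (volume.restrict (Ioi u)).prod (μ.prod μ) =
          (volume.prod (μ.prod μ)).restrict (Ioi u ×ˢ univ) := by
        rw [← Measure.prod_restrict, Measure.restrict_univ]
      rw [this]
      refine (ae_restrict_iff' (measurableSet_Ioi.prod MeasurableSet.univ)).2
        (Eventually.of_forall fun y hy => ?_)
      by_cases hyU : y.2 ∈ U
      · have : y ∈ Ioi (0 : ℝ) ×ˢ U := ⟨hsub hy.1, hyU⟩
        simp only [indicator_of_mem this]
      · exact (hz y.2 hyU _).trans (hz y.2 hyU _).symm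
    -- Integrate over time first: the resulting tail integral of `|p|` is continuous on `U` by
    -- `hP'`, and `f`, `g` cut it off to a compact set.
    refine (integrable_prod_iff' hmeas).2 ⟨Eventually.of_forall fun z => ?_, ?_⟩
    · dsimp only
      by_cases hzU : z ∈ U
      · exact (((hint z.1 z.2 hzU).mono_set hsub).const_mul (f z.1)).mul_const (g z.2)
      · simp only [hz z hzU]
        exact integrable_zero _ _ _
    · refine (integrable_mul_kernel (μ := μ)
        (K := fun a b => ∫ s in Ioi u, |p s a b|) hU hP' hfg).norm.congr
        (Eventually.of_forall fun z => ?_)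
      simp only [norm_mul, Real.norm_eq_abs]
      rw [integral_mul_const, integral_const_mul,
        abs_of_nonneg (integral_nonneg fun s => abs_nonneg _)]
  have h1 : ∫ a, ∫ b, f a * (∫ s in Ioi u, p s a b) * g b ∂μ ∂μ =
      ∫ z, (∫ s in Ioi u, f z.1 * p s z.1 z.2 * g z.2) ∂(μ.prod μ) := by
    rw [← integral_prod (fun z : X × X => f z.1 * (∫ s in Ioi u, p s z.1 z.2) * g z.2)
      (integrable_mul_kernel (K := fun a b => ∫ s in Ioi u, p s a b) hU hP hfg)]
    congr 1 with z
    rw [integral_mul_const, integral_const_mul]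
  rw [h1, ← integral_integral_swap hF]
  refine setIntegral_congr_fun measurableSet_Ioi fun s hs => ?_
  refine integral_prod _ (integrable_mul_kernel (K := p s) hU ?_ hfg)
  exact hp.comp (f := fun z : X × X => (s, z)) (by fun_prop) fun z hz => ⟨hsub hs, hz⟩

/-! ### Symmetry of the heat kernel and the kernel of the inverse -/

variable [μ.IsOpenPosMeasure] {A : Lp ℝ 2 μ →ₗ.[ℝ] Lp ℝ 2 μ}
  {T : ℝ → Lp ℝ 2 μ →L[ℝ] Lp ℝ 2 μ} {U : Set (X × X)} {p : ℝ → X → X → ℝ}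

/-- The heat kernel of a self-adjoint operator is symmetric. -/
theorem heatKernel_symm (hA : IsSelfAdjoint A) (hT : IsHeatSemigroup A T) (hU : IsOpen U)
    (hp : IsHeatKernelOn μ U T p) {u : ℝ} (hu : 0 < u) {a b : X} (hab : (a, b) ∈ U)
    (hba : (b, a) ∈ U) : p u a b = p u b a := by
  have hc : ContinuousOn (fun z : X × X => p u z.1 z.2) U :=
    hp.1.comp (f := fun z : X × X => (u, z)) (by fun_prop) fun z hz => ⟨hu, hz⟩
  -- `U` need not be symmetric, so the comparison takes place on its symmetric part.
  refine kernel_eq_of_integral_eq (μ := μ) (U := U ∩ Prod.swap ⁻¹' U) (K₂ := fun a b => p u b a)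
    (hU.inter (hU.preimage continuous_swap)) (hc.mono inter_subset_left)
    (hc.comp (f := Prod.swap) continuous_swap.continuousOn fun z hz => hz.2) ?_ ⟨hab, hba⟩
  intro f g hfg
  have hgf : tsupport g ×ˢ tsupport f ⊆ U := fun z hz => (hfg (show z.swap ∈ _ from ⟨hz.2, hz.1⟩)).2
  rw [← hp.2 u hu f g (hfg.trans inter_subset_left), ← hT.inner_symm hA hu.le, real_inner_comm,
    hp.2 u hu g f hgf]
  rw [integral_integral_swap (f := fun x y => g x * p u x y * f y)
    (integrable_mul_kernel hU hc hgf)]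
  refine integral_congr_ae (Eventually.of_forall fun x => integral_congr_ae
    (Eventually.of_forall fun y => ?_))
  dsimp only
  ring

/-- The integral kernel of `e^{-uA} A⁻¹` is the time integral of the heat kernel. -/
theorem invKernel_eq_integral_heatKernel (hA : IsSelfAdjoint A) (hpos : IsPosDefOp A)
    (hT : IsHeatSemigroup A T) (hU : IsOpen U) (hp : IsHeatKernelOn μ U T p)
    (hint : ∀ a b, (a, b) ∈ U → IntegrableOn (fun u => p u a b) (Ioi 0))
    (hcont : ContinuousOn (fun z : X × X => ∫ u in Ioi (0 : ℝ), |p u z.1 z.2|) U)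
    {u : ℝ} (hu : 0 ≤ u) {K : X → X → ℝ} (hK : IsInvKernelOn μ U A (T (u / 2)) K)
    {a b : X} (hab : (a, b) ∈ U) : K a b = ∫ s in Ioi u, p s a b := by
  refine kernel_eq_of_integral_eq (μ := μ) (K₂ := fun a b => ∫ s in Ioi u, p s a b) hU hK.1
    (continuousOn_setIntegral_of_continuousOn_integral_abs (Z := X × X) (f := fun s z => p s z.1 z.2) hp.1
      (fun z hz => hint z.1 z.2 hz) hcont (Ioi_subset_Ioi hu)) ?_ hab
  intro f g hfg
  obtain ⟨q₁, q₂, h₁, h₂, h⟩ := hK.2 f g hfg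
  obtain ⟨i₁, e₁⟩ := hT.invForm hA hpos h₁
  obtain ⟨i₂, e₂⟩ := hT.invForm hA hpos h₂
  have hu2 : 0 ≤ u / 2 := by positivity
  -- The two factors `T (u / 2)` shift time by `u`, which turns the integral over `(0, ∞)` into one
  -- over `(u, ∞)`.
  have hadd : ∀ s, 0 < s → ∀ k : Lp ℝ 2 μ,
      ⟪T (u / 2) k, T s (T (u / 2) k)⟫ = ⟪k, T (s + u) k⟫ := fun s hs k => by
    rw [hT.inner_symm hA hu2, ← hT.add_apply hs.le hu2, ← hT.add_apply hu2 (by positivity)]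
    congr 3; ring
  rw [← h, ← e₁, ← e₂, ← integral_sub i₁ i₂, ← integral_div,
    integral_mul_integral_heatKernel hU hp.1 hint hcont hu hfg]
  have e3 : ∫ s in Ioi u, ∫ a, ∫ b, f a * p s a b * g b ∂μ ∂μ =
      ∫ s in Ioi u, ⟪toL2 μ f, T s (toL2 μ g)⟫ :=
    setIntegral_congr_fun measurableSet_Ioi fun s hs => (hp.2 s (hu.trans_lt hs) f g hfg).symm
  rw [e3, ← (measurePreserving_add_right volume u).setIntegral_preimage_emb
    (measurableEmbedding_addRight u) (fun s => ⟪toL2 μ f, T s (toL2 μ g)⟫)]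
  have e4 : (fun s : ℝ => s + u) ⁻¹' Ioi u = Ioi 0 := by ext s; simp
  rw [e4]
  refine setIntegral_congr_fun measurableSet_Ioi fun s (hs : 0 < s) => ?_
  rw [hadd s hs, hadd s hs]
  have h5 : ⟪toL2 μ g, T (s + u) (toL2 μ f)⟫ = ⟪toL2 μ f, T (s + u) (toL2 μ g)⟫ := by
    rw [← hT.inner_symm hA (by positivity), real_inner_comm]
  simp only [map_add, map_sub, inner_add_left, inner_add_right, inner_sub_left, inner_sub_right, h5]
  ring

end Kernels

/-! ### A change of variables for products of functions of one variable -/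

section TreeCoordinates

open scoped Classical

variable {E I : Type*} [Fintype E] [Fintype I] {ι : I → E} (hι : Function.Injective ι)
  (L : (I → ℝ) ≃ᵐ (I → ℝ)) (Δ : E → (I → ℝ) → ℝ)

/-- Coordinates on `ℝᴱ` for which the coordinates in the image of `ι : I → E` are given by
`L s`, `s ∈ ℝᴵ`. -/
noncomputable def treeCoord : (I → ℝ) × ({e // ¬ e ∈ range ι} → ℝ) ≃ᵐ (E → ℝ) :=
  ((L.trans (MeasurableEquiv.piCongrLeft (fun _ => ℝ) (Equiv.ofInjective ι hι))).prodCongr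
    (MeasurableEquiv.refl _)).trans
    (MeasurableEquiv.piEquivPiSubtypeProd (fun _ : E => ℝ) (fun e => e ∈ range ι)).symm

omit [Fintype E] in
theorem treeCoord_apply_image (z : (I → ℝ) × ({e // ¬ e ∈ range ι} → ℝ)) (i : I) :
    treeCoord hι L z (ι i) = L z.1 i := by
  have h : treeCoord hι L z (ι i) = (MeasurableEquiv.piCongrLeft (fun _ => ℝ)
      (Equiv.ofInjective ι hι) (L z.1)) ⟨ι i, mem_range_self i⟩ := by
    change (if h : ι i ∈ range ι then _ else _) = _
    rw [dif_pos (mem_range_self i)]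
    rfl
  rw [h]
  exact Equiv.piCongrLeft_apply_apply (fun _ : range ι => ℝ) (Equiv.ofInjective ι hι) (L z.1) i

omit [Fintype E] in
theorem treeCoord_apply_of_notMem (z : (I → ℝ) × ({e // ¬ e ∈ range ι} → ℝ))
    (e : {e // ¬ e ∈ range ι}) : treeCoord hι L z e = z.2 e := by
  change (if h : e.1 ∈ range ι then _ else _) = _
  rw [dif_neg e.2]
  rfl

theorem measurePreserving_treeCoord (hL : MeasurePreserving L volume volume) :
    MeasurePreserving (treeCoord hι L) (volume.prod volume) volume := by
  refine (volume_preserving_piEquivPiSubtypeProd (fun _ : E => ℝ) (fun e => e ∈ range ι)).symm.comp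
    (MeasurePreserving.prod ?_ (MeasurePreserving.id _))
  have h := (volume_measurePreserving_piCongrLeft (fun _ => ℝ) (Equiv.ofInjective ι hι)).comp hL
  convert h
  rfl

/-- The product of the values of `q e` at `L s` for `e` in the image of `ι`, and of the tail
integrals of `q e` over `(Δ e s, ∞)` for the other `e`. -/
noncomputable def coordIntegrand (ι : I → E) (L : (I → ℝ) ≃ᵐ (I → ℝ)) (Δ : E → (I → ℝ) → ℝ)
    (q : E → ℝ → ℝ) (s : I → ℝ) : ℝ :=
  (∏ i, if 0 < L s i then q (ι i) (L s i) else 0) *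
    ∏ e : {e // ¬ e ∈ range ι}, ∫ τ in Ioi (Δ e s), q e τ

theorem coordIntegrand_eq (Δ : E → (I → ℝ) → ℝ) [Fintype {e // ¬ e ∈ range ι}] (q : E → ℝ → ℝ)
    (s : I → ℝ) : coordIntegrand ι L Δ q s = (∏ i, if 0 < L s i then q (ι i) (L s i) else 0) *
      ∏ e : {e // ¬ e ∈ range ι}, ∫ τ in Ioi (Δ e s), q e τ := by
  unfold coordIntegrand
  congr!

/-- The lengths `u` for which those in the image of `ι` are positive and the others exceed `Δ`. -/
def strictRegion (ι : I → E) (L : (I → ℝ) ≃ᵐ (I → ℝ)) (Δ : E → (I → ℝ) → ℝ) : Set (E → ℝ) :=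
  {u | (∀ i, 0 < u (ι i)) ∧ ∀ e : {e // ¬ e ∈ range ι}, Δ e (L.symm fun i => u (ι i)) < u e}

/-- The lengths `u` for which those in the image of `ι` are positive and the others are at least
`Δ`. -/
def weakRegion (ι : I → E) (L : (I → ℝ) ≃ᵐ (I → ℝ)) (Δ : E → (I → ℝ) → ℝ) : Set (E → ℝ) :=
  {u | (∀ i, 0 < u (ι i)) ∧ ∀ e : {e // ¬ e ∈ range ι}, Δ e (L.symm fun i => u (ι i)) ≤ u e}

variable {L Δ}

theorem measurableSet_strictRegion (hΔ : ∀ e, Measurable (Δ e)) :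
    MeasurableSet (strictRegion ι L Δ) := by
  have h1 : Measurable fun (u : E → ℝ) => L.symm fun i => u (ι i) :=
    L.symm.measurable.comp (measurable_pi_lambda _ fun i => measurable_pi_apply _)
  simp only [strictRegion, Set.ofPred_and, Set.ofPred_forall]
  refine MeasurableSet.inter (MeasurableSet.iInter fun i => ?_) (MeasurableSet.iInter fun e => ?_)
  · exact measurableSet_lt measurable_const (measurable_pi_apply _)
  · exact measurableSet_lt ((hΔ e).comp h1) (measurable_pi_apply _)

omit [Fintype E] in
theorem treeCoord_symm_image (z : (I → ℝ) × ({e // ¬ e ∈ range ι} → ℝ)) :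
    (L.symm fun i => treeCoord hι L z (ι i)) = z.1 := by
  simp only [treeCoord_apply_image]
  exact L.symm_apply_apply z.1

include hι in
-- In tree coordinates `(s, v)` the difference lies in the finitely many graphs `v e = Δ e s`; at
-- fixed `s` each is a hyperplane.
theorem volume_weakRegion_diff_strictRegion (hL : MeasurePreserving L volume volume)
    (hΔ : ∀ e, Measurable (Δ e)) : volume (weakRegion ι L Δ \ strictRegion ι L Δ) = 0 := by
  rw [← (measurePreserving_treeCoord hι L hL).measure_preimage_equiv]
  have hsub : treeCoord hι L ⁻¹' (weakRegion ι L Δ \ strictRegion ι L Δ) ⊆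
      ⋃ e : {e // ¬ e ∈ range ι}, {z | z.2 e = Δ e z.1} := by
    rintro z ⟨⟨hz1, hz2⟩, hz3⟩
    by_contra hne
    simp only [mem_iUnion, not_exists] at hne
    refine hz3 ⟨hz1, fun e => lt_of_le_of_ne (hz2 e) fun h => hne e ?_⟩
    rw [treeCoord_symm_image, treeCoord_apply_of_notMem] at h
    exact h.symm
  refine measure_mono_null hsub (measure_iUnion_null fun e => ?_)
  have hm : MeasurableSet {z : (I → ℝ) × ({e // ¬ e ∈ range ι} → ℝ) | z.2 e = Δ e z.1} :=
    measurableSet_eq_fun ((measurable_pi_apply e).comp measurable_snd)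
      ((hΔ e).comp measurable_fst)
  rw [Measure.measure_prod_null hm]
  refine Eventually.of_forall fun s => ?_
  exact Measure.pi_hyperplane (fun _ : {e // ¬ e ∈ range ι} => (volume : Measure ℝ)) e (Δ e s)

variable {q : E → ℝ → ℝ}

/-- Since `Δ ≥ 0`, the region lies in the positive orthant, where a product of integrable functions
of separate variables is integrable. -/
theorem integrable_indicator_strictRegion (hΔ : ∀ e, Measurable (Δ e)) (hΔ0 : ∀ e s, 0 ≤ Δ e s)
    (hq : ∀ e, IntegrableOn (q e) (Ioi 0)) :
    Integrable ((strictRegion ι L Δ).indicator fun u => ∏ e, q e (u e)) := by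
  have h : Integrable fun u : E → ℝ => ∏ e, (Ioi (0 : ℝ)).indicator (q e) (u e) :=
    Integrable.fintype_prod fun e => (integrable_indicator_iff measurableSet_Ioi).2 (hq e)
  refine (h.indicator (measurableSet_strictRegion (ι := ι) (L := L) hΔ)).congr
    (Eventually.of_forall fun u => ?_)
  by_cases hu : u ∈ strictRegion ι L Δ
  · simp only [indicator_of_mem hu]
    refine Finset.prod_congr rfl fun e _ => ?_
    rw [indicator_of_mem]
    by_cases he : e ∈ range ι
    · obtain ⟨i, rfl⟩ := he
      exact hu.1 i
    · exact (hΔ0 _ _).trans_lt (hu.2 ⟨e, he⟩)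
  · simp only [indicator_of_notMem hu]

include hι in
theorem prod_eq_prod_image_mul_prod_compl (f : E → ℝ) :
    ∏ e, f e = (∏ i, f (ι i)) * ∏ e : {e // ¬ e ∈ range ι}, f e := by
  rw [← Fintype.prod_subtype_mul_prod_subtype (fun e => e ∈ range ι) f]
  congr 1
  have h := (Fintype.prod_equiv (Equiv.ofInjective ι hι) (fun i => f (ι i)) (fun e => f e.1)
    fun i => rfl).symm
  convert h

/-- The thresholds `Δ` depend on `s` alone, so at fixed `s` the region is a product of half-lines
and the remaining lengths can be integrated out one by one. -/
theorem indicator_strictRegion_treeCoord (z : (I → ℝ) × ({e // ¬ e ∈ range ι} → ℝ)) :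
    (strictRegion ι L Δ).indicator (fun u => ∏ e, q e (u e)) (treeCoord hι L z) =
      (∏ i, if 0 < L z.1 i then q (ι i) (L z.1 i) else 0) *
        ∏ e : {e // ¬ e ∈ range ι}, (Ioi (Δ e z.1)).indicator (q e) (z.2 e) := by
  have hs : (L.symm fun i => L z.1 i) = z.1 := L.symm_apply_apply z.1
  by_cases h : treeCoord hι L z ∈ strictRegion ι L Δ
  · rw [indicator_of_mem h, prod_eq_prod_image_mul_prod_compl hι]
    obtain ⟨h1, h2⟩ := h
    simp only [treeCoord_apply_image, treeCoord_apply_of_notMem, hs] at h1 h2 ⊢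
    congr 1
    · exact Finset.prod_congr rfl fun i _ => by rw [if_pos (h1 i)]
    · refine Finset.prod_congr rfl fun e _ => ?_
      exact (indicator_of_mem (mem_Ioi.2 (h2 e)) _).symm
  · rw [indicator_of_notMem h]
    simp only [strictRegion, mem_ofPred_eq, treeCoord_apply_image, treeCoord_apply_of_notMem,
      hs, not_and_or, not_forall] at h
    rcases h with ⟨i, hi⟩ | ⟨e, he⟩
    · rw [Finset.prod_eq_zero (Finset.mem_univ i) (if_neg hi), zero_mul]
    · rw [Finset.prod_eq_zero (Finset.mem_univ e) (indicator_of_notMem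
        (show z.2 e ∉ Ioi (Δ e z.1) from he) (q e)), mul_zero]

theorem integral_indicator_strictRegion_treeCoord (s : I → ℝ) :
    ∫ v, (strictRegion ι L Δ).indicator (fun u => ∏ e, q e (u e)) (treeCoord hι L (s, v)) =
      coordIntegrand ι L Δ q s := by
  simp only [coordIntegrand, indicator_strictRegion_treeCoord]
  rw [integral_const_mul, volume_pi, integral_fintype_prod_eq_prod]
  congr 1
  exact Finset.prod_congr rfl fun e _ => integral_indicator measurableSet_Ioi

include hι in
theorem integrable_coordIntegrand (hL : MeasurePreserving L volume volume)
    (hΔ : ∀ e, Measurable (Δ e)) (hΔ0 : ∀ e s, 0 ≤ Δ e s)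
    (hq : ∀ e, IntegrableOn (q e) (Ioi 0)) :
    Integrable (coordIntegrand ι L Δ q) := by
  have h := ((measurePreserving_treeCoord hι L hL).integrable_comp_emb
    (treeCoord hι L).measurableEmbedding).2 (integrable_indicator_strictRegion (ι := ι) (L := L) hΔ hΔ0 hq)
  refine h.integral_prod_left.congr (Eventually.of_forall fun s => ?_)
  exact integral_indicator_strictRegion_treeCoord hι s

include hι in
theorem integral_coordIntegrand (hL : MeasurePreserving L volume volume)
    (hΔ : ∀ e, Measurable (Δ e)) (hΔ0 : ∀ e s, 0 ≤ Δ e s)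
    (hq : ∀ e, IntegrableOn (q e) (Ioi 0)) :
    ∫ s, coordIntegrand ι L Δ q s =
    ∫ u, (strictRegion ι L Δ).indicator (fun u => ∏ e, q e (u e)) u := by
  have h := ((measurePreserving_treeCoord hι L hL).integrable_comp_emb
    (treeCoord hι L).measurableEmbedding).2 (integrable_indicator_strictRegion (ι := ι) (L := L) hΔ hΔ0 hq)
  rw [← (measurePreserving_treeCoord hι L hL).integral_comp (treeCoord hι L).measurableEmbedding]
  refine Eq.trans ?_ (integral_prod _ h).symm
  congr 1 with s
  exact (integral_indicator_strictRegion_treeCoord hι s).symm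

/-- If the regions attached to a finite family of trees cover the positive orthant up to their
boundaries and are disjoint, a product of integrals is the sum of the integrals in the coordinates
given by the trees. -/
theorem prod_integral_eq_sum_integral_coordIntegrand {Φ : Type*}
    [Fintype Φ] {ι : Φ → I → E} (hι : ∀ F, Function.Injective (ι F))
    {L : Φ → (I → ℝ) ≃ᵐ (I → ℝ)} (hL : ∀ F, MeasurePreserving (L F) volume volume)
    {Δ : E → (I → ℝ) → ℝ} (hΔ : ∀ e, Measurable (Δ e)) (hΔ0 : ∀ e s, 0 ≤ Δ e s)
    (hdisj : ∀ F F' u, u ∈ strictRegion (ι F) (L F) Δ → u ∈ strictRegion (ι F') (L F') Δ → F = F')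
    (hcover : ∀ u, (∀ e, 0 < u e) → ∃ F, u ∈ weakRegion (ι F) (L F) Δ)
    {q : E → ℝ → ℝ} (hq : ∀ e, IntegrableOn (q e) (Ioi 0)) :
    ∏ e, ∫ τ in Ioi (0 : ℝ), q e τ =
      ∑ F, ∫ s, coordIntegrand (ι F) (L F) Δ q s := by
  have h1 : ∏ e, ∫ τ in Ioi (0 : ℝ), q e τ =
      ∫ u : E → ℝ, ∏ e, (Ioi (0 : ℝ)).indicator (q e) (u e) := by
    rw [volume_pi, integral_fintype_prod_eq_prod]
    exact Finset.prod_congr rfl fun e _ => (integral_indicator measurableSet_Ioi).symm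
  have hnull : ∀ᵐ u : E → ℝ, ∀ F, u ∉ weakRegion (ι F) (L F) Δ \ strictRegion (ι F) (L F) Δ :=
    ae_all_iff.2 fun F => measure_eq_zero_iff_ae_notMem.1
      (volume_weakRegion_diff_strictRegion (hι F) (hL F) hΔ)
  rw [h1]
  simp only [integral_coordIntegrand (hι _) (hL _) hΔ hΔ0 hq]
  rw [← integral_finsetSum _ fun F _ => integrable_indicator_strictRegion hΔ hΔ0 hq]
  refine integral_congr_ae ?_
  filter_upwards [hnull] with u hu
  by_cases hpos : ∀ e, 0 < u e
  · obtain ⟨F, hF⟩ := hcover u hpos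
    have hF' : u ∈ strictRegion (ι F) (L F) Δ := by
      by_contra hn
      exact hu F ⟨hF, hn⟩
    rw [Finset.sum_eq_single F, indicator_of_mem hF']
    · exact Finset.prod_congr rfl fun e _ => indicator_of_mem (hpos e) _
    · exact fun F' _ hne => indicator_of_notMem (fun h => hne (hdisj F' F u h hF')) _
    · simp
  -- Off the positive orthant both sides vanish: every strict region forces all lengths to be
  -- positive.
  · obtain ⟨e, he⟩ := not_forall.1 hpos
    rw [Finset.prod_eq_zero (Finset.mem_univ e) (indicator_of_notMem he _)]
    refine (Finset.sum_eq_zero fun F _ => indicator_of_notMem (fun h => he ?_) _).symm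
    by_cases her : e ∈ range (ι F)
    · obtain ⟨i, rfl⟩ := her
      exact h.1 i
    · exact (hΔ0 _ _).trans_lt (h.2 ⟨e, her⟩)

end TreeCoordinates

/-! ### Spanning forests and fictitious times -/

namespace CombMap

variable {n : ℕ} {D : Type*} [Fintype D] (G : CombMap n D)

/-- The edges as a type. -/
abbrev Edge : Type _ := {e : Sym2 D // e ∈ G.edges}

/-- The edge to which a half-edge belongs. -/
noncomputable def edge (h : D) : G.Edge :=
  ⟨s(h, G.α h), by classical exact Finset.mem_image_of_mem _ (Finset.mem_univ h)⟩

variable {G}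

theorem edge_eq_iff {h h' : D} : G.edge h = G.edge h' ↔ h = h' ∨ h = G.α h' := by
  rw [Subtype.ext_iff]
  change s(h, G.α h) = s(h', G.α h') ↔ _
  rw [Sym2.eq_iff]
  constructor
  · rintro (h1 | h1)
    · exact Or.inl h1.1
    · exact Or.inr h1.1
  · rintro (rfl | rfl)
    · exact Or.inl ⟨rfl, rfl⟩
    · exact Or.inr ⟨rfl, G.α_invol _⟩

theorem edge_α (h : D) : G.edge (G.α h) = G.edge h := edge_eq_iff.2 (Or.inr rfl)

theorem exists_edge_eq (e : G.Edge) : ∃ h, G.edge h = e := by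
  classical
  obtain ⟨h, -, hh⟩ := Finset.mem_image.1 e.2
  exact ⟨h, Subtype.ext hh⟩

theorem mk_out {D : Type*} (e : Sym2 D) : s((Quot.out e).1, (Quot.out e).2) = e := Quot.out_eq e

theorem out_edge (h : D) :
    ((Quot.out (G.edge h).1).1 = h ∧ (Quot.out (G.edge h).1).2 = G.α h) ∨
      ((Quot.out (G.edge h).1).1 = G.α h ∧ (Quot.out (G.edge h).1).2 = h) :=
  Sym2.eq_iff.1 (mk_out (G.edge h).1)

theorem α_out (e : G.Edge) : G.α (Quot.out e.1).1 = (Quot.out e.1).2 := by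
  obtain ⟨h, rfl⟩ := exists_edge_eq e
  rcases out_edge (G := G) h with h1 | h1
  · rw [h1.1, h1.2]
  · rw [h1.1, h1.2, G.α_invol]

omit [Fintype D] in
theorem time_of_isExt (t : ℝ) (s : G.Internal → ℝ) {v : G.Vertex} (hv : G.IsExt v) :
    G.time t s v = t := dif_pos hv

omit [Fintype D] in
theorem time_internal (t : ℝ) (s : G.Internal → ℝ) (w : G.Internal) :
    G.time t s w.1 = s w := dif_neg w.2

omit [Fintype D] in
theorem parent_of_isExt (ℓ : G.Labelling) {v : G.Vertex} (hv : G.IsExt v) : G.parent ℓ v = v :=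
  dif_pos hv

omit [Fintype D] in
theorem parent_internal (ℓ : G.Labelling) (w : G.Internal) :
    G.parent ℓ w.1 = G.vertex (G.α (ℓ.1 w)) := dif_neg w.2

omit [Fintype D] in
theorem measurable_time (t : ℝ) (v : G.Vertex) : Measurable fun s => G.time t s v := by
  by_cases hv : G.IsExt v
  · simp only [time_of_isExt _ _ hv]; exact measurable_const
  · simp only [time_internal _ _ ⟨v, hv⟩]
    exact measurable_pi_apply (⟨v, hv⟩ : G.Internal)

/-! ### Forests as coordinates on the internal times -/

namespace SpanningForest

omit [Fintype D] in
/-- Induction from the external vertices towards the leaves of a spanning forest. -/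
theorem induction (F : G.SpanningForest) {P : G.Vertex → Prop} (hext : ∀ v, G.IsExt v → P v)
    (hstep : ∀ w : G.Internal, P (G.parent F.1 w.1) → P w.1) (v : G.Vertex) : P v := by
  obtain ⟨k, hk⟩ := F.2 v
  induction k generalizing v with
  | zero => exact hext v hk
  | succ k ih =>
    rw [Function.iterate_succ_apply] at hk
    by_cases hv : G.IsExt v
    · exact hext v hv
    · exact hstep ⟨v, hv⟩ (ih _ hk)

/-- The edge joining an internal vertex to its parent. -/
noncomputable def parentEdge (F : G.SpanningForest) (w : G.Internal) : G.Edge :=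
  G.edge (F.1.1 w)

/-- If an edge were used from both of its ends, the two vertices would be each other's parents, and
going upwards would never reach an external vertex. -/
theorem injective_parentEdge (F : G.SpanningForest) : Function.Injective F.parentEdge := by
  intro w w' h
  rcases edge_eq_iff.1 h with h | h
  · have := congrArg G.vertex h
    rw [F.1.2 w, F.1.2 w'] at this
    exact Subtype.ext this
  · have h1 : G.parent F.1 w'.1 = w.1 := by rw [parent_internal, ← h, F.1.2 w]
    have h2 : G.parent F.1 w.1 = w'.1 := by rw [parent_internal, h, G.α_invol, F.1.2 w']
    have key : w.1 ≠ w.1 ∧ w.1 ≠ w'.1 := F.induction (P := fun v => v ≠ w.1 ∧ v ≠ w'.1)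
      (fun v hv => ⟨fun h => w.2 (h ▸ hv), fun h => w'.2 (h ▸ hv)⟩)
      (fun v hv => ⟨fun h => hv.2 (h ▸ h2), fun h => hv.1 (h ▸ h1)⟩) w.1
    exact absurd rfl key.1

/-- The map sending times of the internal vertices to the times of their parents, with the
external vertices at time zero. -/
noncomputable def parentShift (F : G.SpanningForest) :
    (G.Internal → ℝ) →ₗ[ℝ] (G.Internal → ℝ) where
  toFun s w := G.time 0 s (G.parent F.1 w.1)
  map_add' s s' := by
    ext w
    by_cases hv : G.IsExt (G.parent F.1 w.1)
    · simp [time_of_isExt _ _ hv]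
    · simp [time, hv]
  map_smul' c s := by
    ext w
    by_cases hv : G.IsExt (G.parent F.1 w.1)
    · simp [time_of_isExt _ _ hv]
    · simp [time, hv]

omit [Fintype D] in
theorem time_parentShift (F : G.SpanningForest) (s : G.Internal → ℝ) (v : G.Vertex) :
    G.time 0 (F.parentShift s) v = G.time 0 s (G.parent F.1 v) := by
  by_cases hv : G.IsExt v
  · rw [time_of_isExt _ _ hv, parent_of_isExt _ hv, time_of_isExt _ _ hv]
  · exact time_internal 0 (F.parentShift s) ⟨v, hv⟩

omit [Fintype D] in
theorem time_parentShift_pow (F : G.SpanningForest) (k : ℕ) (s : G.Internal → ℝ) (v : G.Vertex) :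
    G.time 0 ((F.parentShift ^ k) s) v = G.time 0 s ((G.parent F.1)^[k] v) := by
  induction k generalizing s with
  | zero => rfl
  | succ k ih =>
    rw [pow_succ, Module.End.mul_apply, ih, time_parentShift, Function.iterate_succ_apply']

/-- The `k`-th power reads off the time of the `k`-th ancestor, which for large `k` is external and
has time zero. The sum of the heights is an exponent that serves all vertices. -/
theorem isNilpotent_parentShift (F : G.SpanningForest) : IsNilpotent F.parentShift := by
  choose k hk using F.2
  have hext : ∀ v, ∀ m, k v ≤ m → G.IsExt ((G.parent F.1)^[m] v) := by
    intro v m hm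
    induction m, hm using Nat.le_induction with
    | base => exact hk v
    | succ m _ ih => rw [Function.iterate_succ_apply', parent_of_isExt _ ih]; exact ih
  refine ⟨∑ w : G.Internal, k w.1, LinearMap.ext fun s => funext fun w => ?_⟩
  rw [← time_internal 0 ((F.parentShift ^ _) s) w, time_parentShift_pow]
  exact time_of_isExt _ _ (hext _ _ (Finset.single_le_sum (f := fun w : G.Internal => k w.1)
    (fun _ _ => Nat.zero_le _) (Finset.mem_univ w)))

/-- A nilpotent map has characteristic polynomial `X ^ d`; its value at `1` is `det (1 -
parentShift) = 1`. -/
theorem abs_det_parentShift_sub_one (F : G.SpanningForest) :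
    |LinearMap.det (F.parentShift - 1)| = 1 := by
  classical
  have h1 : LinearMap.det (1 - F.parentShift) = 1 := by
    have h2 := ((LinearMap.charpoly_nilpotent_tfae F.parentShift).out 0 1).1
      F.isNilpotent_parentShift
    rw [← LinearMap.charpoly_toMatrix F.parentShift (Pi.basisFun ℝ G.Internal)] at h2
    have h3 := Matrix.eval_charpoly (LinearMap.toMatrix (Pi.basisFun ℝ G.Internal)
      (Pi.basisFun ℝ G.Internal) F.parentShift) 1
    rw [h2, Polynomial.eval_pow, Polynomial.eval_X, one_pow, map_one] at h3
    rw [← LinearMap.det_toMatrix (Pi.basisFun ℝ G.Internal), map_sub, LinearMap.toMatrix_one, h3]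
  have h4 : F.parentShift - 1 = (-1 : ℝ) • (1 - F.parentShift) := by
    refine LinearMap.ext fun s => ?_
    simp
  rw [h4, LinearMap.det_smul, h1, mul_one, abs_pow, abs_neg, abs_one, one_pow]

/-- The change of variables from the times of the internal vertices to the time differences along
the edges of the forest. -/
noncomputable def timeDiff (F : G.SpanningForest) (t : ℝ) :
    (G.Internal → ℝ) ≃ᵐ (G.Internal → ℝ) :=
  have hdet : LinearMap.det (F.parentShift - 1) ≠ 0 := fun h => by
    have := F.abs_det_parentShift_sub_one
    rw [h, abs_zero] at this
    exact zero_ne_one this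
  ((LinearMap.equivOfDetNeZero (F.parentShift - 1) hdet).toContinuousLinearEquiv.toHomeomorph.trans
    -- The linear part places the external vertices at time zero; the translation adds `t` at the
    -- vertices whose parent is external.
    (Homeomorph.addRight fun w => G.time t 0 (G.parent F.1 w.1))).toMeasurableEquiv

theorem timeDiff_apply (F : G.SpanningForest) (t : ℝ) (s : G.Internal → ℝ) (w : G.Internal) :
    F.timeDiff t s w = G.time t s (G.parent F.1 w.1) - G.time t s w.1 := by
  have h : F.timeDiff t s w = (G.time 0 s (G.parent F.1 w.1) - s w) +
    G.time t 0 (G.parent F.1 w.1) := rfl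
  rw [h, time_internal]
  by_cases hv : G.IsExt (G.parent F.1 w.1)
  · simp only [time_of_isExt _ _ hv]; ring
  · simp [time, hv]

theorem measurePreserving_timeDiff (F : G.SpanningForest) (t : ℝ) :
    MeasurePreserving (F.timeDiff t) volume volume := by
  have hdet : LinearMap.det (F.parentShift - 1) ≠ 0 := fun h => by
    have := F.abs_det_parentShift_sub_one
    rw [h, abs_zero] at this
    exact zero_ne_one this
  have h1 : MeasurePreserving (F.parentShift - 1 : (G.Internal → ℝ) →ₗ[ℝ] (G.Internal → ℝ))
      volume volume := by
    refine ⟨(LinearMap.continuous_of_finiteDimensional _).measurable, ?_⟩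
    rw [Real.map_linearMap_volume_pi_eq_smul_volume_pi hdet, abs_inv,
      F.abs_det_parentShift_sub_one]
    simp
  exact (measurePreserving_add_right volume
    (fun w : G.Internal => G.time t 0 (G.parent F.1 w.1))).comp h1

end SpanningForest

/-- The absolute value of the time difference between the ends of an edge. -/
noncomputable def edgeDiff (G : CombMap n D) (t : ℝ) (e : G.Edge) (s : G.Internal → ℝ) : ℝ :=
  |G.time t s (G.vertex (Quot.out e.1).1) - G.time t s (G.vertex (Quot.out e.1).2)|

theorem edgeDiff_edge (t : ℝ) (h : D) (s : G.Internal → ℝ) :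
    G.edgeDiff t (G.edge h) s = |G.time t s (G.vertex h) - G.time t s (G.vertex (G.α h))| := by
  rcases out_edge (G := G) h with h1 | h1
  · rw [edgeDiff, h1.1, h1.2]
  · rw [edgeDiff, h1.1, h1.2, abs_sub_comm]

theorem measurable_edgeDiff (t : ℝ) (e : G.Edge) : Measurable (G.edgeDiff t e) :=
  ((measurable_time t _).sub (measurable_time t _)).abs

/-- A forest is determined by the edge lengths of which it is the shortest path forest. -/
theorem spanningForest_unique {t : ℝ} {u : G.Edge → ℝ} (hu : ∀ e, 0 < u e)
    {F F' : G.SpanningForest} {s s' : G.Internal → ℝ}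
    (h1 : ∀ w, G.time t s (G.parent F.1 w.1) - G.time t s w.1 = u (F.parentEdge w))
    (h1' : ∀ w, G.time t s' (G.parent F'.1 w.1) - G.time t s' w.1 = u (F'.parentEdge w))
    (h2 : ∀ e, e ∉ range F.parentEdge → G.edgeDiff t e s < u e)
    (h2' : ∀ e, e ∉ range F'.parentEdge → G.edgeDiff t e s' < u e) : F = F' := by
  -- The times of `F` are `1`-Lipschitz for the lengths `u`: equality holds on forest edges, strict
  -- inequality elsewhere.
  have hle : ∀ {F : G.SpanningForest} {s : G.Internal → ℝ},
      (∀ w, G.time t s (G.parent F.1 w.1) - G.time t s w.1 = u (F.parentEdge w)) →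
      (∀ e, e ∉ range F.parentEdge → G.edgeDiff t e s < u e) →
      ∀ h, G.time t s (G.vertex (G.α h)) - G.time t s (G.vertex h) ≤ u (G.edge h) := by
    intro F s h1 h2 h
    by_cases he : G.edge h ∈ range F.parentEdge
    · obtain ⟨w, hw⟩ := he
      have h3 := h1 w
      rw [parent_internal, ← F.1.2 w] at h3
      rw [← hw]
      have h4 := hu (F.parentEdge w)
      rcases edge_eq_iff.1 hw with h5 | h5
      · rw [← h5, ← h3]
      · have h6 : G.α (F.1.1 w) = h := by rw [h5, G.α_invol]
        rw [← h5, ← h6]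
        linarith
    · have := h2 _ he
      rw [edgeDiff_edge, abs_sub_comm] at this
      exact (le_abs_self _).trans this.le
  -- Descending `F'` from its roots, `s'` drops by the full length of each edge and `s` by at most
  -- that length.
  have hmono : ∀ {F F' : G.SpanningForest} {s s' : G.Internal → ℝ},
      (∀ h, G.time t s (G.vertex (G.α h)) - G.time t s (G.vertex h) ≤ u (G.edge h)) →
      (∀ w, G.time t s' (G.parent F'.1 w.1) - G.time t s' w.1 = u (F'.parentEdge w)) →
      ∀ v, G.time t s' v ≤ G.time t s v := by
    intro F F' s s' h3 h4 v
    refine F'.induction (P := fun v => G.time t s' v ≤ G.time t s v) (fun v hv => ?_)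
      (fun w hw => ?_) v
    · rw [time_of_isExt _ _ hv, time_of_isExt _ _ hv]
    · have h5 := h4 w
      have h6 := h3 (F'.1.1 w)
      rw [F'.1.2 w, ← parent_internal] at h6
      change _ ≤ u (F'.parentEdge w) at h6
      linarith
  have heq : ∀ v, G.time t s' v = G.time t s v := fun v =>
    le_antisymm (hmono (F := F) (F' := F') (hle h1 h2) h1' v)
      (hmono (F := F') (F' := F) (hle h1' h2') h1 v)
  refine Subtype.ext (Subtype.ext (funext fun w => ?_))
  -- Both forests have the same times. An edge of `F'` outside `F` would have time difference equal
  -- to its length, against strictness in `h2`.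
  have h3 : F'.parentEdge w ∈ range F.parentEdge := by
    by_contra hn
    have h4 := h2 _ hn
    have h5 := h1' w
    rw [heq, heq, parent_internal, ← F'.1.2 w] at h5
    rw [SpanningForest.parentEdge, edgeDiff_edge, abs_sub_comm, h5] at h4
    exact absurd h4 (not_lt.2 (le_abs_self _))
  obtain ⟨w₂, hw₂⟩ := h3
  rcases edge_eq_iff.1 hw₂ with h4 | h4
  · have h5 := congrArg G.vertex h4
    rw [F.1.2 w₂, F'.1.2 w] at h5
    rw [← Subtype.ext h5, h4, Subtype.ext h5]
  -- The same edge used in opposite directions: time would increase strictly both ways.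
  · have h5 := h1 w₂
    have h6 := h1' w
    rw [heq, heq, parent_internal, ← F'.1.2 w, ← h4, F.1.2 w₂] at h6
    have h7 : G.α (F.1.1 w₂) = F'.1.1 w := by rw [h4, G.α_invol]
    rw [parent_internal, h7] at h5
    have := hu (F.parentEdge w₂)
    have := hu (F'.parentEdge w)
    linarith

/-- The times of a rooted map cannot be far from that of the external vertices if the time
differences along the edges are bounded. -/
theorem exists_abs_time_sub_le (G : CombMap n D) (t : ℝ) (u : G.Edge → ℝ) : ∃ M : ℝ,
    ∀ s : G.Internal → ℝ,
      (∀ h, G.time t s (G.vertex h) - G.time t s (G.vertex (G.α h)) ≤ u (G.edge h)) →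
      ∀ v, |G.time t s v - t| ≤ M := by
  set S : Set (G.Internal → ℝ) := {s | ∀ h, G.time t s (G.vertex h) -
    G.time t s (G.vertex (G.α h)) ≤ u (G.edge h)} with hS
  -- `σ` stays at a vertex and `α` crosses one edge, in either direction within its length. Hence
  -- each group element changes times by an amount bounded uniformly over `S`, and some element
  -- leads to an external vertex.
  have key : ∀ η ∈ Subgroup.closure {G.σ, G.α}, ∃ M : ℝ, ∀ s ∈ S, ∀ h,
      |G.time t s (G.vertex (η h)) - G.time t s (G.vertex h)| ≤ M := by
    intro η hη
    induction hη using Subgroup.closure_induction with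
    | mem η hη =>
      rcases hη with rfl | hη
      · refine ⟨0, fun s _ h => ?_⟩
        have : G.vertex (G.σ h) = G.vertex h :=
          Quotient.sound (Equiv.Perm.sameCycle_apply_left.2 (Equiv.Perm.SameCycle.refl _ _))
        rw [this, sub_self, abs_zero]
      · rw [mem_singleton_iff] at hη
        subst hη
        refine ⟨∑ e, |u e|, fun s hs h => ?_⟩
        have h1 := hs h
        have h2 := hs (G.α h)
        rw [G.α_invol, edge_α] at h2
        refine le_trans (abs_le.2 ⟨?_, h2⟩) ((le_abs_self _).trans
          (Finset.single_le_sum (f := fun e => |u e|) (fun _ _ => abs_nonneg _)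
            (Finset.mem_univ (G.edge h))))
        linarith
    | one => exact ⟨0, fun s _ h => by simp⟩
    | mul η η' _ _ h1 h2 =>
      obtain ⟨M, hM⟩ := h1
      obtain ⟨M', hM'⟩ := h2
      refine ⟨M + M', fun s hs h => ?_⟩
      refine (abs_sub_le _ (G.time t s (G.vertex (η' h))) _).trans ?_
      exact add_le_add (hM s hs (η' h)) (hM' s hs h)
    | inv η _ h1 =>
      obtain ⟨M, hM⟩ := h1
      refine ⟨M, fun s hs h => ?_⟩
      have := hM s hs (η⁻¹ h)
      rwa [show η (η⁻¹ h) = h from η.apply_symm_apply h, abs_sub_comm] at this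
  have key' : ∀ h : D, ∃ M : ℝ, ∀ s ∈ S, |G.time t s (G.vertex h) - t| ≤ M := by
    intro h
    obtain ⟨ν, ⟨-, η, hη, hh⟩, -⟩ := G.exists_unique_root h
    obtain ⟨M, hM⟩ := key η hη
    refine ⟨M, fun s hs => ?_⟩
    have := hM s hs h
    rwa [hh, time_of_isExt t s ⟨ν, rfl⟩, abs_sub_comm] at this
  choose M hM using key'
  refine ⟨∑ h, |M h|, fun s hs v => ?_⟩
  obtain ⟨h, rfl⟩ : ∃ h, G.vertex h = v := Quotient.exists_rep v
  exact (hM h s hs).trans ((le_abs_self _).trans (Finset.single_le_sum (f := fun h => |M h|)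
    (fun _ _ => abs_nonneg _) (Finset.mem_univ h)))

/-- For all positive edge lengths there is a shortest path forest. -/
theorem exists_spanningForest (G : CombMap n D) (t : ℝ) {u : G.Edge → ℝ} (hu : ∀ e, 0 < u e) :
    ∃ (F : G.SpanningForest) (s : G.Internal → ℝ),
      (∀ w, G.time t s (G.parent F.1 w.1) - G.time t s w.1 = u (F.parentEdge w)) ∧
      ∀ e, G.edgeDiff t e s ≤ u e := by
  classical
  set S : Set (G.Internal → ℝ) := {s | ∀ h, G.time t s (G.vertex h) -
    G.time t s (G.vertex (G.α h)) ≤ u (G.edge h)} with hS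
  have hcont : ∀ v, Continuous fun s => G.time t s v := fun v => by
    by_cases hv : G.IsExt v
    · simp only [time_of_isExt _ _ hv]; exact continuous_const
    · simp only [time_internal _ _ ⟨v, hv⟩]; exact continuous_apply (⟨v, hv⟩ : G.Internal)
  have hclosed : IsClosed S := by
    rw [hS]
    simp only [Set.ofPred_forall]
    exact isClosed_iInter fun h => isClosed_le ((hcont _).sub (hcont _)) continuous_const
  obtain ⟨M, hM⟩ := G.exists_abs_time_sub_le t u
  have hcpt : IsCompact S := by
    refine (isCompact_univ_pi fun _ : G.Internal =>
      isCompact_Icc (a := t - M) (b := t + M)).of_isClosed_subset hclosed fun s hs w _ => ?_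
    have := abs_le.1 (hM s hs w.1)
    rw [time_internal] at this
    exact ⟨by linarith, by linarith⟩
  have hne : S.Nonempty := by
    refine ⟨fun _ => t, fun h => ?_⟩
    have : ∀ v, G.time t (fun _ => t) v = t := fun v => by
      unfold time; split_ifs <;> rfl
    rw [this, this, sub_self]
    exact (hu _).le
  -- The times `t` minus distance are the pointwise smallest elements of `S`, so minimizing the sum
  -- finds them.
  obtain ⟨s, hs, hmin⟩ := hcpt.exists_isMinOn hne
    (f := fun s : G.Internal → ℝ => ∑ w, s w) (by fun_prop)
  -- At the minimum no single time can be lowered, so every internal vertex has an edge whose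
  -- constraint is saturated; it becomes the parent edge.
  have htight : ∀ w : G.Internal, ∃ h, G.vertex h = w.1 ∧
      G.time t s (G.vertex (G.α h)) - G.time t s w.1 = u (G.edge h) := by
    intro w
    by_contra! hno
    have hslack : ∀ h, G.vertex h = w.1 →
        0 < u (G.edge h) - (G.time t s (G.vertex (G.α h)) - G.time t s w.1) := fun h hh => by
      have h1 := hs (G.α h)
      rw [G.α_invol, edge_α, hh] at h1
      exact sub_pos.2 (lt_of_le_of_ne h1 (hno h hh))
    obtain ⟨ε, hε, hεle⟩ : ∃ ε : ℝ, 0 < ε ∧ ∀ h, G.vertex h = w.1 →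
        ε ≤ u (G.edge h) - (G.time t s (G.vertex (G.α h)) - G.time t s w.1) := by
      obtain ⟨h₀, hh₀⟩ : ∃ h, G.vertex h = w.1 := Quotient.exists_rep w.1
      obtain ⟨h', hh', hle⟩ := Finset.exists_min_image
        (Finset.univ.filter fun h : D => G.vertex h = w.1)
        (fun h => u (G.edge h) - (G.time t s (G.vertex (G.α h)) - G.time t s w.1))
        ⟨h₀, by simpa using hh₀⟩
      exact ⟨_, hslack h' (by simpa using hh'), fun h hh => hle h (by simpa using hh)⟩
    have htime : ∀ v, G.time t (Function.update s w (s w - ε)) v =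
        if v = w.1 then G.time t s w.1 - ε else G.time t s v := by
      intro v
      by_cases hv : G.IsExt v
      · have : v ≠ w.1 := fun h => w.2 (h ▸ hv)
        rw [if_neg this, time_of_isExt _ _ hv, time_of_isExt _ _ hv]
      · have e1 := time_internal t (Function.update s w (s w - ε)) ⟨v, hv⟩
        have e2 := time_internal t s ⟨v, hv⟩
        dsimp only at e1 e2
        rw [e1, e2, time_internal]
        by_cases h : v = w.1
        · subst h; simp
        · have : (⟨v, hv⟩ : G.Internal) ≠ w := fun h' => h (congrArg Subtype.val h')
          rw [if_neg h, Function.update_of_ne this]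
    -- Lowering the time of `w` tightens only the constraints of half-edges whose opposite end is at
    -- `w`, and `ε` is at most their slack. Loops at `w` see no difference.
    have hs' : Function.update s w (s w - ε) ∈ S := by
      intro h
      rw [htime, htime]
      have h1 := hs h
      have h2 := hu (G.edge h)
      split_ifs with h3 h4 h4
      · rw [sub_self]; exact h2.le
      · rw [h3] at h1; linarith
      · have h5 := hεle (G.α h) h4
        rw [G.α_invol, edge_α] at h5
        linarith
      · exact h1
    have h1 := hmin hs'
    dsimp only at h1
    have h2 : ∑ w', Function.update s w (s w - ε) w' = ∑ w', s w' - ε := by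
      rw [Finset.sum_update_of_mem (Finset.mem_univ w),
        ← Finset.add_sum_erase Finset.univ s (Finset.mem_univ w), Finset.sdiff_singleton_eq_erase]
      ring
    have h3 : ∑ w', s w' ≤ ∑ w', Function.update s w (s w - ε) w' := h1
    linarith
  choose ℓ hℓ hℓ' using htight
  have hlt : ∀ w : G.Internal, G.time t s w.1 < G.time t s (G.parent ⟨ℓ, hℓ⟩ w.1) := fun w => by
    have := hu (G.edge (ℓ w))
    rw [← hℓ' w, sub_pos] at this
    rwa [parent_internal]
  have hforest : ∀ v, ∃ k : ℕ, G.IsExt ((G.parent ⟨ℓ, hℓ⟩)^[k] v) := by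
    -- Times increase strictly towards the parent, which cannot continue forever among finitely many
    -- vertices.
    have hwf : WellFounded fun v v' : G.Vertex => G.time t s v' < G.time t s v := by
      have : IsTrans G.Vertex fun v v' => G.time t s v' < G.time t s v :=
        ⟨fun _ _ _ h1 h2 => h2.trans h1⟩
      have : Std.Irrefl fun v v' : G.Vertex => G.time t s v' < G.time t s v :=
        ⟨fun _ => lt_irrefl _⟩
      exact Finite.wellFounded_of_trans_of_irrefl _
    intro v
    induction v using hwf.induction with
    | _ v ih =>
      by_cases hv : G.IsExt v
      · exact ⟨0, hv⟩
      · obtain ⟨k, hk⟩ := ih _ (hlt ⟨v, hv⟩)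
        exact ⟨k + 1, by rwa [Function.iterate_succ_apply]⟩
  refine ⟨⟨⟨ℓ, hℓ⟩, hforest⟩, s, fun w => ?_, fun e => ?_⟩
  · rw [parent_internal]; exact hℓ' w
  · obtain ⟨h, rfl⟩ := exists_edge_eq e
    have h1 := hs h
    have h2 := hs (G.α h)
    rw [G.α_invol, edge_α] at h2
    rw [edgeDiff_edge]
    exact abs_le.2 ⟨by linarith, h1⟩

/-- The integrand obtained from functions `q e` attached to the edges `e`: the value of `q e` at
the time difference for the edges of a forest, and tail integrals of `q e` for the other edges. -/
noncomputable def treeIntegrand (q : G.Edge → ℝ → ℝ) (F : G.SpanningForest) (t : ℝ) :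
    (G.Internal → ℝ) → ℝ :=
  coordIntegrand F.parentEdge (F.timeDiff t) (G.edgeDiff t) q

theorem integrable_treeIntegrand {q : G.Edge → ℝ → ℝ} (hq : ∀ e, IntegrableOn (q e) (Ioi 0))
    (F : G.SpanningForest) (t : ℝ) : Integrable (treeIntegrand q F t) := by
  exact integrable_coordIntegrand F.injective_parentEdge (F.measurePreserving_timeDiff t)
    (measurable_edgeDiff t) (fun _ _ => abs_nonneg _) hq

/-- A product over the edges of integrals over `(0, ∞)` is a sum over the spanning forests of
integrals over the times of the internal vertices. -/
theorem prod_integral_eq_sum_treeIntegrand {q : G.Edge → ℝ → ℝ}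
    (hq : ∀ e, IntegrableOn (q e) (Ioi 0)) (t : ℝ) :
    ∏ e, ∫ τ in Ioi (0 : ℝ), q e τ = ∑ F : G.SpanningForest, ∫ s, treeIntegrand q F t s := by
  have hsymm : ∀ (F : G.SpanningForest) (u : G.Edge → ℝ) (w : G.Internal),
      G.time t ((F.timeDiff t).symm fun i => u (F.parentEdge i)) (G.parent F.1 w.1) -
        G.time t ((F.timeDiff t).symm fun i => u (F.parentEdge i)) w.1 = u (F.parentEdge w) :=
    fun F u w => by rw [← F.timeDiff_apply, MeasurableEquiv.apply_symm_apply]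
  refine prod_integral_eq_sum_integral_coordIntegrand (Δ := G.edgeDiff t) (q := q)
    (ι := fun F : G.SpanningForest => F.parentEdge)
    (L := fun F : G.SpanningForest => F.timeDiff t) (fun F => F.injective_parentEdge)
    (fun F => F.measurePreserving_timeDiff t) (measurable_edgeDiff t) (fun _ _ => abs_nonneg _)
    ?_ ?_ hq
  · intro F F' u h h'
    have hu : ∀ e, 0 < u e := fun e => by
      by_cases he : e ∈ range F.parentEdge
      · obtain ⟨i, rfl⟩ := he
        exact h.1 i
      · exact lt_of_le_of_lt (abs_nonneg _) (h.2 ⟨e, he⟩)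
    exact spanningForest_unique hu (hsymm F u) (hsymm F' u) (fun e he => h.2 ⟨e, he⟩)
      (fun e he => h'.2 ⟨e, he⟩)
  · intro u hu
    obtain ⟨F, s, h1, h2⟩ := G.exists_spanningForest t hu
    refine ⟨F, fun i => hu _, fun e => ?_⟩
    have hs : (F.timeDiff t).symm (fun i => u (F.parentEdge i)) = s := by
      rw [MeasurableEquiv.symm_apply_eq]
      funext w
      rw [F.timeDiff_apply, h1]
    rw [hs]
    exact h2 e

end CombMap

/-! ### Independence of the numbering of the half-edges -/

namespace CombMap

variable {n : ℕ} {D : Type*} [Fintype D] {G : CombMap n D}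

theorem deg_pos (v : G.Vertex) : 0 < G.deg v := by
  obtain ⟨h, hh⟩ : ∃ h, G.vertex h = v := Quotient.exists_rep v
  have : Nonempty {h : D // G.vertex h = v} := ⟨⟨h, hh⟩⟩
  exact Nat.card_pos

theorem σ_pow_deg {h : D} (hv : ¬ G.IsExt (G.vertex h)) : (G.σ ^ G.deg (G.vertex h)) h = h := by
  classical
  have hmv : h ∈ G.σ.support := Equiv.Perm.mem_support.2 fun hfix => by
    obtain ⟨ν, hν⟩ := (G.σ_fixed h).1 hfix
    exact hv ⟨ν, by rw [hν]⟩
  have hcard : G.deg (G.vertex h) = (G.σ.cycleOf h).support.card := by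
    rw [deg, Nat.card_eq_fintype_card, Fintype.card_subtype]
    congr 1
    ext b
    rw [Equiv.Perm.mem_support_cycleOf_iff, Finset.mem_filter]
    exact ⟨fun hb => ⟨(Quotient.exact hb.2.symm : G.σ.SameCycle h b), hmv⟩,
      fun hb => ⟨Finset.mem_univ b, Quotient.sound hb.1.symm⟩⟩
  rw [hcard]
  rw [← Equiv.Perm.pow_mod_card_support_cycleOf_self_apply, Nat.mod_self, pow_zero,
    Equiv.Perm.one_apply]

omit [Fintype D] in
theorem vertex_σ_pow (k : ℕ) (h : D) : G.vertex ((G.σ ^ k) h) = G.vertex h :=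
  Quotient.sound (Equiv.Perm.sameCycle_pow_left.2 (Equiv.Perm.SameCycle.refl _ _))

/-- By `exists_index` the numbering is onto the `deg v` half-edges of `v`, and a surjection between
finite sets of equal size is injective. -/
theorem σ_pow_injective (ℓ : G.Labelling) (v : G.Internal) :
    Function.Injective fun i : Fin (G.deg v.1) => (G.σ ^ (i : ℕ)) (ℓ.1 v) := by
  classical
  let f : Fin (G.deg v.1) → {h : D // G.vertex h = v.1} := fun i =>
    ⟨(G.σ ^ (i : ℕ)) (ℓ.1 v), by rw [vertex_σ_pow, ℓ.2 v]⟩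
  have hsurj : Function.Surjective f := by
    rintro ⟨h, hh⟩
    obtain ⟨v, hv⟩ := v
    dsimp only at hh
    subst hh
    obtain ⟨i, hi⟩ := G.exists_index ℓ h hv
    exact ⟨i, Subtype.ext hi⟩
  have hbij : Function.Bijective f := by
    rw [Fintype.bijective_iff_surjective_and_card]
    exact ⟨hsurj, by rw [Fintype.card_fin, deg, Nat.card_eq_fintype_card]⟩
  intro i j hij
  exact hbij.1 (Subtype.ext hij)

theorem val_finRotate {d : ℕ} (i : Fin d) :
    (finRotate d i : ℕ) = if (i : ℕ) + 1 = d then 0 else (i : ℕ) + 1 := by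
  cases d with
  | zero => exact i.elim0
  | succ d =>
    by_cases h : i = Fin.last d
    · subst h; simp
    · rw [coe_finRotate_of_ne_last h, if_neg]
      exact fun h' => h (Fin.ext (by simpa using h'))

theorem σ_pow_finRotate (ℓ : G.Labelling) (v : G.Internal) (i : Fin (G.deg v.1)) :
    (G.σ ^ (finRotate _ i : ℕ)) (ℓ.1 v) = G.σ ((G.σ ^ (i : ℕ)) (ℓ.1 v)) := by
  rw [val_finRotate, ← Equiv.Perm.mul_apply, ← pow_succ']
  split_ifs with h
  · have := σ_pow_deg (G := G) (h := ℓ.1 v) (by rw [ℓ.2 v]; exact v.2)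
    rw [ℓ.2 v] at this
    rw [h, this, pow_zero, Equiv.Perm.one_apply]
  · rfl

theorem σ_pow_iterate_finRotate (ℓ : G.Labelling) (v : G.Internal) (k : ℕ)
    (i : Fin (G.deg v.1)) :
    (G.σ ^ (((finRotate _)^[k] i : Fin (G.deg v.1)) : ℕ)) (ℓ.1 v) =
      (G.σ ^ k) ((G.σ ^ (i : ℕ)) (ℓ.1 v)) := by
  induction k with
  | zero => rfl
  | succ k ih =>
    rw [Function.iterate_succ_apply', σ_pow_finRotate, ih, pow_succ', Equiv.Perm.mul_apply]

theorem iterate_comp_apply {ι X : Type*} (ρ : ι → ι) (k : ℕ) (y : ι → X) (i : ι) :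
    (fun y : ι → X => y ∘ ρ)^[k] y i = y (ρ^[k] i) := by
  induction k generalizing y with
  | zero => rfl
  | succ k ih => rw [Function.iterate_succ_apply, ih, Function.iterate_succ_apply']; rfl

theorem pos_of_isExt {X : Type*} (ℓ ℓ' : G.Labelling) (x : Fin n → X) (y y' : G.Config X) {h : D}
    (hv : G.IsExt (G.vertex h)) : G.pos ℓ x y h = G.pos ℓ' x y' h := by
  rw [pos, pos, dif_pos hv, dif_pos hv]

theorem pos_of_not_isExt {X : Type*} (ℓ : G.Labelling) (x : Fin n → X) (y : G.Config X) {h : D}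
    (hv : ¬ G.IsExt (G.vertex h)) :
    G.pos ℓ x y h = y ⟨G.vertex h, hv⟩ (G.index ℓ h hv) := by
  rw [pos, dif_neg hv]

/-- A change of the numbering of the half-edges amounts to a measure preserving transformation of
the positions which leaves the vertex kernels invariant. -/
theorem exists_relabelling {X : Type*} [MeasurableSpace X] (V : VertexKernels X)
    (ℓ₁ ℓ₂ : G.Labelling) :
    ∃ Φ : G.Config X → G.Config X, MeasurePreserving Φ (G.posMeasure V) (G.posMeasure V) ∧
      (∀ (x : Fin n → X) y h, G.pos ℓ₁ x y h = G.pos ℓ₂ x (Φ y) h) ∧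
      ∀ y v, V.dens (G.deg v.1) (Φ y v) = V.dens (G.deg v.1) (y v) := by
  have hk : ∀ v : G.Internal, ∃ k : ℕ, (G.σ ^ k) (ℓ₁.1 v) = ℓ₂.1 v := fun v => by
    have hsc : G.σ.SameCycle (ℓ₁.1 v) (ℓ₂.1 v) := Quotient.exact ((ℓ₁.2 v).trans (ℓ₂.2 v).symm)
    obtain ⟨k, -, hk⟩ := hsc.exists_pow_eq'
    exact ⟨k, hk⟩
  choose k hk using hk
  refine ⟨fun y v => (fun y : Fin (G.deg v.1) → X => y ∘ finRotate _)^[k v] (y v), ?_, ?_, ?_⟩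
  · have : ∀ v : G.Internal, SigmaFinite (V.ref (G.deg v.1)) := fun v =>
      V.sigmaFinite _ (deg_pos v.1)
    exact measurePreserving_pi _ _ fun v => (V.ref_cyclic (G.deg v.1)).iterate (k v)
  · intro x y h
    by_cases hv : G.IsExt (G.vertex h)
    · exact pos_of_isExt _ _ _ _ _ hv
    · rw [pos_of_not_isExt _ _ _ hv, pos_of_not_isExt _ _ _ hv]
      dsimp only
      rw [iterate_comp_apply]
      congr 1
      -- Two labels agree if they name the same half-edge. The numbering `ℓ₂` starts `k` steps after
      -- `ℓ₁`, so `k` rotations convert its labels.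
      apply σ_pow_injective ℓ₁ ⟨G.vertex h, hv⟩
      have e := σ_pow_iterate_finRotate ℓ₁ ⟨G.vertex h, hv⟩ (k ⟨G.vertex h, hv⟩) (G.index ℓ₂ h hv)
      refine Eq.trans ?_ e.symm
      rw [← Equiv.Perm.mul_apply, (Commute.refl G.σ).pow_pow _ _,
        Equiv.Perm.mul_apply, hk]
      exact ((G.exists_index ℓ₁ h hv).choose_spec).trans
        ((G.exists_index ℓ₂ h hv).choose_spec).symm
  · intro y v
    dsimp only
    generalize k v = m
    induction m with
    | zero => rfl
    | succ m ih => rw [Function.iterate_succ_apply', V.dens_cyclic, ih]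

end CombMap

/-! ### Comparison of the amplitudes -/

namespace CombMap

variable {n : ℕ} {D : Type*} [Fintype D] {G : CombMap n D} {X : Type*} [MeasurableSpace X]
  (V : VertexKernels X)

instance : SigmaFinite (G.posMeasure V) := by
  have : ∀ v : G.Internal, SigmaFinite (V.ref (G.deg v.1)) := fun v =>
    V.sigmaFinite _ (deg_pos v.1)
  unfold posMeasure
  infer_instance

/-- The integrand of the stochastic amplitude, with the integration variables numbered by a
labelling `ℓ` that need not be the one defined by the forest. -/
noncomputable def labelledIntegrand (p N : ℝ → X → X → ℝ) (F : G.SpanningForest)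
    (ℓ : G.Labelling) (t : ℝ) (x : Fin n → X) (z : (G.Internal → ℝ) × G.Config X) : ℝ :=
  open Classical in
  (∏ w : G.Internal,
    if G.time t z.1 w.1 < G.time t z.1 (G.parent F.1 w.1) then
      p (G.time t z.1 (G.parent F.1 w.1) - G.time t z.1 w.1)
        (G.pos ℓ x z.2 (G.α (F.1.1 w))) (G.pos ℓ x z.2 (F.1.1 w))
    else 0) *
  (∏ e ∈ G.edges \ F.edges,
    N |G.time t z.1 (G.vertex (Quot.out e).1) - G.time t z.1 (G.vertex (Quot.out e).2)|
      (G.pos ℓ x z.2 (Quot.out e).1) (G.pos ℓ x z.2 (Quot.out e).2)) *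
  ∏ v : G.Internal, -(V.dens (G.deg v.1) (z.2 v))

omit [MeasurableSpace X] in
/-- The positions of the ends of every edge are in `U`. -/
def EdgesIn (U : Set (X × X)) (ℓ : G.Labelling) (x : Fin n → X) (y : G.Config X) : Prop :=
  ∀ h, (G.pos ℓ x y h, G.pos ℓ x y (G.α h)) ∈ U

/-- The propagator of an edge as a function of its length. -/
noncomputable def edgeKernel (p : ℝ → X → X → ℝ) (ℓ : G.Labelling) (x : Fin n → X)
    (y : G.Config X) (e : G.Edge) (τ : ℝ) : ℝ :=
  p τ (G.pos ℓ x y (Quot.out e.1).1) (G.pos ℓ x y (Quot.out e.1).2)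

variable {V} {U : Set (X × X)} {ℓ : G.Labelling} {x : Fin n → X} {y : G.Config X}

omit [MeasurableSpace X] in
theorem EdgesIn.out_mem (hy : EdgesIn U ℓ x y) (e : G.Edge) :
    (G.pos ℓ x y (Quot.out e.1).1, G.pos ℓ x y (Quot.out e.1).2) ∈ U := by
  rw [← α_out]; exact hy _

omit [MeasurableSpace X] in
theorem EdgesIn.α_mem (hy : EdgesIn U ℓ x y) (h : D) :
    (G.pos ℓ x y (G.α h), G.pos ℓ x y h) ∈ U := by
  have := hy (G.α h)
  rwa [G.α_invol] at this

omit [MeasurableSpace X] in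
theorem edgeKernel_edge {p : ℝ → X → X → ℝ} {τ : ℝ}
    (hsymm : ∀ a b, (a, b) ∈ U → (b, a) ∈ U → p τ a b = p τ b a)
    (hy : EdgesIn U ℓ x y) (h : D) :
    edgeKernel p ℓ x y (G.edge h) τ = p τ (G.pos ℓ x y (G.α h)) (G.pos ℓ x y h) := by
  rcases out_edge (G := G) h with h1 | h1
  · rw [edgeKernel, h1.1, h1.2]
    exact hsymm _ _ (hy h) (hy.α_mem h)
  · rw [edgeKernel, h1.1, h1.2]

theorem mem_forestEdges_iff (F : G.SpanningForest) (e : G.Edge) :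
    e.1 ∈ F.edges ↔ e ∈ range F.parentEdge := by
  classical
  rw [SpanningForest.edges, Finset.mem_image]
  constructor
  · rintro ⟨w, -, hw⟩
    exact ⟨w, Subtype.ext (Sym2.eq_swap.trans hw)⟩
  · rintro ⟨w, rfl⟩
    exact ⟨w, Finset.mem_univ w, Sym2.eq_swap⟩

theorem prod_edges_sdiff [DecidableEq (Sym2 D)] (F : G.SpanningForest)
    [Fintype {e : G.Edge // ¬ e ∈ range F.parentEdge}] (f : Sym2 D → ℝ) :
    ∏ e ∈ G.edges \ F.edges, f e = ∏ e : {e : G.Edge // ¬ e ∈ range F.parentEdge}, f e.1.1 := by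
  symm
  refine Finset.prod_bij (fun e _ => e.1.1) (fun e _ => ?_) (fun e _ e' _ h => ?_)
    (fun e he => ?_) fun e _ => rfl
  · exact Finset.mem_sdiff.2 ⟨e.1.2, fun h => e.2 ((mem_forestEdges_iff F e.1).1 h)⟩
  · exact Subtype.ext (Subtype.ext h)
  · obtain ⟨h1, h2⟩ := Finset.mem_sdiff.1 he
    exact ⟨⟨⟨e, h1⟩, fun h => h2 ((mem_forestEdges_iff F ⟨e, h1⟩).2 h)⟩, Finset.mem_univ _, rfl⟩

/-- Forest edges run from parent to child, whereas `edgeKernel` uses the arbitrary orientation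
chosen by `Quot.out`; symmetry of `p` reconciles the two. -/
theorem labelledIntegrand_eq {p N : ℝ → X → X → ℝ}
    (hsymm : ∀ τ, 0 < τ → ∀ a b, (a, b) ∈ U → (b, a) ∈ U → p τ a b = p τ b a)
    (hN : ∀ u, 0 ≤ u → ∀ a b, (a, b) ∈ U → N u a b = ∫ τ in Ioi u, p τ a b)
    (F : G.SpanningForest) (t : ℝ) (hy : EdgesIn U ℓ x y) (s : G.Internal → ℝ) :
    labelledIntegrand V p N F ℓ t x (s, y) =
      treeIntegrand (edgeKernel p ℓ x y) F t s * ∏ v, -(V.dens (G.deg v.1) (y v)) := by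
  classical
  rw [labelledIntegrand, treeIntegrand, coordIntegrand_eq, prod_edges_sdiff F]
  congr 2
  · refine Finset.prod_congr rfl fun w _ => ?_
    simp only [SpanningForest.timeDiff_apply, sub_pos]
    by_cases h : G.time t s w.1 < G.time t s (G.parent F.1 w.1)
    · rw [if_pos h, if_pos h, SpanningForest.parentEdge,
        edgeKernel_edge (hsymm _ (sub_pos.2 h)) hy]
    · rw [if_neg h, if_neg h]
  · exact Finset.prod_congr rfl fun e _ => hN _ (abs_nonneg _) _ _ (hy.out_mem e.1)

theorem feynmanIntegrand_eq {p : ℝ → X → X → ℝ} {C : X → X → ℝ}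
    (hC : ∀ a b, (a, b) ∈ U → C a b = ∫ τ in Ioi (0 : ℝ), p τ a b) (hy : EdgesIn U ℓ x y) :
    G.feynmanIntegrand V C ℓ x y =
      (∏ e, ∫ τ in Ioi (0 : ℝ), edgeKernel p ℓ x y e τ) *
        ∏ v, -(V.dens (G.deg v.1) (y v)) := by
  rw [feynmanIntegrand, ← Finset.prod_coe_sort]
  congr 1
  exact Finset.prod_congr rfl fun e _ => hC _ _ (hy.out_mem e)

omit [MeasurableSpace X] in
theorem integrableOn_edgeKernel {p : ℝ → X → X → ℝ}
    (hint : ∀ a b, (a, b) ∈ U → IntegrableOn (fun u => p u a b) (Ioi 0)) (hy : EdgesIn U ℓ x y)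
    (e : G.Edge) : IntegrableOn (edgeKernel p ℓ x y e) (Ioi 0) :=
  hint _ _ (hy.out_mem e)

theorem feynmanIntegrand_eq_sum {p N : ℝ → X → X → ℝ} {C : X → X → ℝ}
    (hint : ∀ a b, (a, b) ∈ U → IntegrableOn (fun u => p u a b) (Ioi 0))
    (hsymm : ∀ τ, 0 < τ → ∀ a b, (a, b) ∈ U → (b, a) ∈ U → p τ a b = p τ b a)
    (hN : ∀ u, 0 ≤ u → ∀ a b, (a, b) ∈ U → N u a b = ∫ τ in Ioi u, p τ a b)
    (hC : ∀ a b, (a, b) ∈ U → C a b = ∫ τ in Ioi (0 : ℝ), p τ a b)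
    (t : ℝ) (hy : EdgesIn U ℓ x y) :
    G.feynmanIntegrand V C ℓ x y =
      ∑ F : G.SpanningForest, ∫ s, labelledIntegrand V p N F ℓ t x (s, y) := by
  rw [feynmanIntegrand_eq hC hy,
    prod_integral_eq_sum_treeIntegrand (integrableOn_edgeKernel hint hy) t, Finset.sum_mul]
  refine Finset.sum_congr rfl fun F _ => ?_
  simp only [labelledIntegrand_eq hsymm hN F t hy]
  rw [integral_mul_const]

theorem treeIntegrand_nonneg {q : G.Edge → ℝ → ℝ} (hq : ∀ e τ, 0 ≤ q e τ) (F : G.SpanningForest)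
    (t : ℝ) (s : G.Internal → ℝ) : 0 ≤ treeIntegrand q F t s := by
  refine mul_nonneg (Finset.prod_nonneg fun w _ => ?_)
    (Finset.prod_nonneg fun e _ => integral_nonneg fun τ => hq _ _)
  split_ifs
  · exact hq _ _
  · exact le_rfl

theorem abs_treeIntegrand_le (q : G.Edge → ℝ → ℝ) (F : G.SpanningForest)
    (t : ℝ) (s : G.Internal → ℝ) :
    |treeIntegrand q F t s| ≤ treeIntegrand (fun e τ => |q e τ|) F t s := by
  rw [treeIntegrand, treeIntegrand, coordIntegrand, coordIntegrand, abs_mul, Finset.abs_prod,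
    Finset.abs_prod]
  refine mul_le_mul (Finset.prod_le_prod (fun _ _ => abs_nonneg _) fun w _ => ?_)
    (Finset.prod_le_prod (fun _ _ => abs_nonneg _) fun e _ => abs_integral_le_integral_abs)
    (Finset.prod_nonneg fun _ _ => abs_nonneg _) (Finset.prod_nonneg fun w _ => ?_)
  · split_ifs
    · exact le_rfl
    · rw [abs_zero]
  · split_ifs
    · exact abs_nonneg _
    · exact le_rfl

/-- The time integral of the absolute value of the stochastic integrand is bounded by the Feynman
integrand with absolute propagators. -/
theorem integral_abs_treeIntegrand_le {q : G.Edge → ℝ → ℝ}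
    (hq : ∀ e, IntegrableOn (q e) (Ioi 0)) (F : G.SpanningForest) (t : ℝ) :
    ∫ s, |treeIntegrand q F t s| ≤ ∏ e, ∫ τ in Ioi (0 : ℝ), |q e τ| := by
  have hq' : ∀ e, IntegrableOn (fun τ => |q e τ|) (Ioi 0) := fun e => (hq e).abs
  rw [prod_integral_eq_sum_treeIntegrand hq' t]
  refine (integral_mono (integrable_treeIntegrand hq F t).abs (integrable_treeIntegrand hq' F t)
    fun s => abs_treeIntegrand_le q F t s).trans ?_
  -- For `|q|` all forests contribute nonnegatively, so one of them is at most the total, which is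
  -- the product.
  exact Finset.single_le_sum (f := fun F => ∫ s, treeIntegrand (fun e τ => |q e τ|) F t s)
    (fun F _ => integral_nonneg fun s => treeIntegrand_nonneg (fun _ _ => abs_nonneg _) F t s)
    (Finset.mem_univ F)

theorem measurable_pos (ℓ : G.Labelling) (x : Fin n → X) (h : D) :
    Measurable fun y : G.Config X => G.pos ℓ x y h := by
  by_cases hv : G.IsExt (G.vertex h)
  · simp only [pos, dif_pos hv]; exact measurable_const
  · simp only [pos_of_not_isExt ℓ x _ hv]
    exact (measurable_pi_apply _).comp (measurable_pi_apply (⟨G.vertex h, hv⟩ : G.Internal))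

theorem measurable_labelledIntegrand {p N : ℝ → X → X → ℝ}
    (hp : Measurable fun z : ℝ × X × X => p z.1 z.2.1 z.2.2)
    (hN : Measurable fun z : ℝ × X × X => N z.1 z.2.1 z.2.2)
    (F : G.SpanningForest) (ℓ : G.Labelling) (t : ℝ) (x : Fin n → X) :
    Measurable (labelledIntegrand V p N F ℓ t x) := by
  have ht : ∀ v, Measurable fun z : (G.Internal → ℝ) × G.Config X => G.time t z.1 v := fun v =>
    (measurable_time t v).comp measurable_fst
  have hx : ∀ h, Measurable fun z : (G.Internal → ℝ) × G.Config X => G.pos ℓ x z.2 h := fun h =>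
    (measurable_pos ℓ x h).comp measurable_snd
  refine ((Finset.measurable_fun_prod _ fun w _ => ?_).mul
    (Finset.measurable_fun_prod _ fun e _ => ?_)).mul (Finset.measurable_fun_prod _ fun v _ => ?_)
  · refine Measurable.ite (measurableSet_lt (ht _) (ht _)) ?_ measurable_const
    exact hp.comp (((ht _).sub (ht _)).prodMk ((hx _).prodMk (hx _)))
  · exact hN.comp (((ht _).sub (ht _)).abs.prodMk ((hx _).prodMk (hx _)))
  · exact ((V.measurable_dens _).comp ((measurable_pi_apply v).comp measurable_snd)).neg

/-- Neither `p` nor `N` is assumed measurable off `U`. The zero extension of `p` and its tail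
integrals are measurable and give the same integrand for almost all positions. -/
theorem aestronglyMeasurable_labelledIntegrand {p N : ℝ → X → X → ℝ}
    (hp : Measurable ((Ioi (0 : ℝ) ×ˢ U).indicator fun z : ℝ × X × X => p z.1 z.2.1 z.2.2))
    (hN : ∀ u, 0 ≤ u → ∀ a b, (a, b) ∈ U → N u a b = ∫ τ in Ioi u, p τ a b)
    (hreg : ∀ᵐ y ∂(G.posMeasure V), EdgesIn U ℓ x y) (F : G.SpanningForest) (t : ℝ) :
    AEStronglyMeasurable (labelledIntegrand V p N F ℓ t x) (volume.prod (G.posMeasure V)) := by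
  classical
  set p' : ℝ → X → X → ℝ := fun τ a b =>
    (Ioi (0 : ℝ) ×ˢ U).indicator (fun z : ℝ × X × X => p z.1 z.2.1 z.2.2) (τ, a, b) with hp'
  have hpp : ∀ τ, 0 < τ → ∀ a b, (a, b) ∈ U → p τ a b = p' τ a b := fun τ hτ a b hab =>
    (indicator_of_mem (s := Ioi (0 : ℝ) ×ˢ U) (a := (τ, a, b)) ⟨hτ, hab⟩
      fun z : ℝ × X × X => p z.1 z.2.1 z.2.2).symm
  have hN' : Measurable fun z : ℝ × X × X => ∫ τ in Ioi z.1, p' τ z.2.1 z.2.2 := by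
    have h1 : Measurable fun y : (ℝ × X × X) × ℝ =>
        {y : (ℝ × X × X) × ℝ | y.1.1 < y.2}.indicator (fun y => p' y.2 y.1.2.1 y.1.2.2) y :=
      (hp.comp (measurable_snd.prodMk measurable_fst.snd)).indicator
        (measurableSet_lt measurable_fst.fst measurable_snd)
    have h2 := h1.stronglyMeasurable.integral_prod_right' (ν := (volume : Measure ℝ))
    convert h2.measurable using 2 with z
    rw [← integral_indicator measurableSet_Ioi]
    rfl
  have hm := measurable_labelledIntegrand (V := V) (p := p')
    (N := fun u a b => ∫ τ in Ioi u, p' τ a b) hp hN' F ℓ t x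
  refine hm.aestronglyMeasurable.congr ?_
  have hreg' : ∀ᵐ z ∂((volume : Measure (G.Internal → ℝ)).prod (G.posMeasure V)),
      EdgesIn U ℓ x z.2 := Measure.quasiMeasurePreserving_snd.ae hreg
  filter_upwards [hreg'] with z hz
  unfold labelledIntegrand
  congr 2
  · refine Finset.prod_congr rfl fun w _ => ?_
    split_ifs with h
    · exact (hpp _ (sub_pos.2 h) _ _ (hz.α_mem _)).symm
    · rfl
  · refine Finset.prod_congr rfl fun e he => ?_
    have hmem := hz.out_mem ⟨e, (Finset.mem_sdiff.1 he).1⟩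
    rw [hN _ (abs_nonneg _) _ _ hmem]
    refine setIntegral_congr_fun measurableSet_Ioi fun τ hτ => ?_
    exact (hpp _ ((abs_nonneg _).trans_lt hτ) _ _ hmem).symm

/-- Absolute convergence of the stochastic amplitudes. -/
theorem integrable_labelledIntegrand {p N : ℝ → X → X → ℝ}
    (hp : Measurable ((Ioi (0 : ℝ) ×ˢ U).indicator fun z : ℝ × X × X => p z.1 z.2.1 z.2.2))
    (hint : ∀ a b, (a, b) ∈ U → IntegrableOn (fun u => p u a b) (Ioi 0))
    (hsymm : ∀ τ, 0 < τ → ∀ a b, (a, b) ∈ U → (b, a) ∈ U → p τ a b = p τ b a)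
    (hN : ∀ u, 0 ≤ u → ∀ a b, (a, b) ∈ U → N u a b = ∫ τ in Ioi u, p τ a b)
    (hreg : ∀ᵐ y ∂(G.posMeasure V), EdgesIn U ℓ x y)
    (h : Integrable (G.feynmanIntegrand V (fun a b => ∫ u in Ioi (0 : ℝ), |p u a b|) ℓ x)
      (G.posMeasure V)) (F : G.SpanningForest) (t : ℝ) :
    Integrable (labelledIntegrand V p N F ℓ t x) (volume.prod (G.posMeasure V)) := by
  have hm := aestronglyMeasurable_labelledIntegrand hp hN hreg F t
  -- Tonelli with the times integrated first, at fixed positions; the bound for the remaining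
  -- integral is the Feynman integrand with `|C|`.
  refine (integrable_prod_iff' hm).2 ⟨?_, h.mono hm.norm.prod_swap.integral_prod_right' ?_⟩
  · filter_upwards [hreg] with y hy
    simp only [labelledIntegrand_eq hsymm hN F t hy]
    exact (integrable_treeIntegrand (integrableOn_edgeKernel hint hy) F t).mul_const _
  · filter_upwards [hreg] with y hy
    rw [feynmanIntegrand_eq (p := fun u a b => |p u a b|) (fun _ _ _ => rfl) hy]
    simp only [labelledIntegrand_eq hsymm hN F t hy, norm_mul]
    rw [integral_mul_const, norm_mul, norm_norm]
    refine mul_le_mul_of_nonneg_right ?_ (norm_nonneg _)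
    rw [Real.norm_of_nonneg (integral_nonneg fun s => norm_nonneg _)]
    exact (integral_abs_treeIntegrand_le (integrableOn_edgeKernel hint hy) F t).trans
      (le_abs_self _)

/-- The Feynman amplitude is the sum of the stochastic amplitudes. -/
theorem feynman_eq_sum_labelled {p N : ℝ → X → X → ℝ} {C : X → X → ℝ}
    (hint : ∀ a b, (a, b) ∈ U → IntegrableOn (fun u => p u a b) (Ioi 0))
    (hsymm : ∀ τ, 0 < τ → ∀ a b, (a, b) ∈ U → (b, a) ∈ U → p τ a b = p τ b a)
    (hN : ∀ u, 0 ≤ u → ∀ a b, (a, b) ∈ U → N u a b = ∫ τ in Ioi u, p τ a b)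
    (hC : ∀ a b, (a, b) ∈ U → C a b = ∫ τ in Ioi (0 : ℝ), p τ a b)
    (hreg : ∀ᵐ y ∂(G.posMeasure V), EdgesIn U ℓ x y) (t : ℝ)
    (h : ∀ F : G.SpanningForest,
      Integrable (labelledIntegrand V p N F ℓ t x) (volume.prod (G.posMeasure V))) :
    Integrable (G.feynmanIntegrand V C ℓ x) (G.posMeasure V) ∧
      G.feynmanAmplitude V C ℓ x = ∑ F : G.SpanningForest,
        ∫ z, labelledIntegrand V p N F ℓ t x z ∂(volume.prod (G.posMeasure V)) := by
  have hae : (fun y => ∑ F : G.SpanningForest, ∫ s, labelledIntegrand V p N F ℓ t x (s, y))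
      =ᵐ[G.posMeasure V] G.feynmanIntegrand V C ℓ x := by
    filter_upwards [hreg] with y hy
    exact (feynmanIntegrand_eq_sum hint hsymm hN hC t hy).symm
  have hi : ∀ F : G.SpanningForest,
      Integrable (fun y => ∫ s, labelledIntegrand V p N F ℓ t x (s, y)) (G.posMeasure V) :=
    fun F => (h F).integral_prod_right
  refine ⟨(integrable_finsetSum _ fun F _ => hi F).congr hae, ?_⟩
  rw [feynmanAmplitude, ← integral_congr_ae hae, integral_finsetSum _ fun F _ => hi F]
  exact Finset.sum_congr rfl fun F _ => (integral_prod_symm _ (h F)).symm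

section Relabelling

variable {ℓ₁ ℓ₂ : G.Labelling} {Φ : G.Config X → G.Config X}
  (hpos : ∀ y h, G.pos ℓ₁ x y h = G.pos ℓ₂ x (Φ y) h)

include hpos in
omit [MeasurableSpace X] in
theorem edgesIn_relabel : EdgesIn U ℓ₂ x (Φ y) ↔ EdgesIn U ℓ₁ x y := by
  simp only [EdgesIn, hpos]

include hpos in
theorem feynmanIntegrand_relabel
    (hdens : ∀ y v, V.dens (G.deg v.1) (Φ y v) = V.dens (G.deg v.1) (y v)) (C : X → X → ℝ) :
    G.feynmanIntegrand V C ℓ₁ x = G.feynmanIntegrand V C ℓ₂ x ∘ Φ := by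
  funext y
  simp only [feynmanIntegrand, Function.comp, hpos, hdens]

include hpos in
theorem labelledIntegrand_relabel
    (hdens : ∀ y v, V.dens (G.deg v.1) (Φ y v) = V.dens (G.deg v.1) (y v))
    (p N : ℝ → X → X → ℝ) (F : G.SpanningForest) (t : ℝ) :
    labelledIntegrand V p N F ℓ₁ t x = labelledIntegrand V p N F ℓ₂ t x ∘ Prod.map id Φ := by
  funext z
  simp only [labelledIntegrand, Function.comp, Prod.map_fst, Prod.map_snd, id, hpos, hdens]

end Relabelling

end CombMap

theorem theorem2 {X : Type*} [TopologicalSpace X] [LocallyCompactSpace X] [T2Space X]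
    [SecondCountableTopology X] [MeasurableSpace X] [BorelSpace X]
    (μ : Measure X) [IsFiniteMeasureOnCompacts μ] [μ.IsOpenPosMeasure]
    -- the closed self-adjoint positive definite operator `A` and `T t = e^{-tA}`
    (A : Lp ℝ 2 μ →ₗ.[ℝ] Lp ℝ 2 μ) (hA : IsSelfAdjoint A) (hpos : IsPosDefOp A)
    (T : ℝ → Lp ℝ 2 μ →L[ℝ] Lp ℝ 2 μ) (hT : IsHeatSemigroup A T)
    -- the kernels of `e^{-tA}`, `A⁻¹` and `e^{-uA} A⁻¹`, regular on the open set `U`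
    (U : Set (X × X)) (hU : IsOpen U) (p N : ℝ → X → X → ℝ) (C : X → X → ℝ)
    (hp : IsHeatKernelOn μ U T p) (hC : IsInvKernelOn μ U A 1 C)
    (hN : ∀ u, 0 ≤ u → IsInvKernelOn μ U A (T (u / 2)) (N u))
    (hint : ∀ a b, (a, b) ∈ U → IntegrableOn (fun u => p u a b) (Ioi 0))
    (hcont : ContinuousOn (fun z : X × X => ∫ u in Ioi (0 : ℝ), |p u z.1 z.2|) U)
    -- the vertex kernels, the map and the external positions and time
    (V : VertexKernels X) {n : ℕ} {D : Type*} [Fintype D] (G : CombMap n D) (ℓ : G.Labelling)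
    (x : Fin n → X) (t : ℝ)
    (hreg : ∀ h : D, ∀ᵐ y ∂(G.posMeasure V), (G.pos ℓ x y h, G.pos ℓ x y (G.α h)) ∈ U) :
    (Integrable (G.feynmanIntegrand V (fun a b => ∫ u in Ioi (0 : ℝ), |p u a b|) ℓ x)
        (G.posMeasure V) →
      ∀ F : G.SpanningForest, Integrable (CombMap.stochasticIntegrand V p N F t x)
        (volume.prod (G.posMeasure V))) ∧
    ((∀ F : G.SpanningForest, Integrable (CombMap.stochasticIntegrand V p N F t x)
        (volume.prod (G.posMeasure V))) →
      Integrable (G.feynmanIntegrand V C ℓ x) (G.posMeasure V) ∧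
      G.feynmanAmplitude V C ℓ x =
        ∑ F : G.SpanningForest, CombMap.stochasticAmplitude V p N F t x) := by
  have hN' : ∀ u, 0 ≤ u → ∀ a b, (a, b) ∈ U → N u a b = ∫ τ in Ioi u, p τ a b :=
    fun u hu a b hab =>
      invKernel_eq_integral_heatKernel hA hpos hT hU hp hint hcont hu (hN u hu) hab
  -- `C` is the case `u = 0`, because `T 0 = 1`.
  have hC' : ∀ a b, (a, b) ∈ U → C a b = ∫ τ in Ioi (0 : ℝ), p τ a b := fun a b hab =>
    invKernel_eq_integral_heatKernel hA hpos hT hU hp hint hcont le_rfl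
      (by rw [zero_div, hT.zero]; exact hC) hab
  have hsymm : ∀ τ, 0 < τ → ∀ a b, (a, b) ∈ U → (b, a) ∈ U → p τ a b = p τ b a :=
    fun τ hτ a b hab hba => heatKernel_symm hA hT hU hp hτ hab hba
  have hpm := measurable_indicator_heatKernel hU hp.1
  have hreg' : ∀ᵐ y ∂(G.posMeasure V), CombMap.EdgesIn U ℓ x y := ae_all_iff.2 hreg
  have hst : ∀ F : G.SpanningForest, CombMap.stochasticIntegrand V p N F t x =
      CombMap.labelledIntegrand V p N F F.1 t x := fun F => rfl
  refine ⟨fun h F => ?_, fun h => ?_⟩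
  -- The stochastic integrand numbers half-edges by the forest, the Feynman integrand by `ℓ`; `Φ`
  -- transports integrability from `ℓ` to `F.1`.
  · obtain ⟨Φ, hΦ, hΦpos, hΦdens⟩ := CombMap.exists_relabelling V F.1 ℓ
    rw [hst]
    refine CombMap.integrable_labelledIntegrand hpm hint hsymm hN' ?_ ?_ F t
    · filter_upwards [hΦ.quasiMeasurePreserving.ae hreg'] with y hy
      exact (CombMap.edgesIn_relabel (hΦpos x)).1 hy
    · rw [CombMap.feynmanIntegrand_relabel (hΦpos x) hΦdens]
      exact hΦ.integrable_comp_of_integrable h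
  -- The sum over forests requires common variables, so every stochastic amplitude is rewritten in
  -- the numbering `ℓ`.
  · have key : ∀ F : G.SpanningForest,
        Integrable (CombMap.labelledIntegrand V p N F ℓ t x) (volume.prod (G.posMeasure V)) ∧
        ∫ z, CombMap.labelledIntegrand V p N F ℓ t x z ∂(volume.prod (G.posMeasure V)) =
          CombMap.stochasticAmplitude V p N F t x := by
      intro F
      obtain ⟨Φ, hΦ, hΦpos, hΦdens⟩ := CombMap.exists_relabelling V ℓ F.1
      have hMP := (MeasurePreserving.id (volume : Measure (G.Internal → ℝ))).prod hΦ
      have hF := h F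
      rw [CombMap.labelledIntegrand_relabel (hΦpos x) hΦdens, ← hst]
      refine ⟨hMP.integrable_comp_of_integrable hF, ?_⟩
      have hmap := integral_map (μ := (volume : Measure (G.Internal → ℝ)).prod (G.posMeasure V))
        hMP.measurable.aemeasurable (f := CombMap.stochasticIntegrand V p N F t x)
        (by rw [hMP.map_eq]; exact hF.aestronglyMeasurable)
      rw [hMP.map_eq] at hmap
      exact hmap.symm.trans (integral_prod _ hF)
    obtain ⟨h1, h2⟩ := CombMap.feynman_eq_sum_labelled hint hsymm hN' hC' hreg' t
      fun F => (key F).1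
    exact ⟨h1, h2.trans (Finset.sum_congr rfl fun F _ => (key F).2)⟩
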